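/- Let $\mathcal H$ and $\widehat{\mathcal H}$ be complex Hilbert spaces, let $A$ be a self-adjoint operator in $\mathcal H$ with compact resolvent and bounded from below, let $B:\widehat{\mathcal H}\to\mathcal H$ be a non-zero bounded linear operator, and let $c\in\mathbb R$. For $\lambda\in\mathbb C\setminus\{c\}$ let $$\mathcal S(\lambda)=A-\lambda-\frac{BB^*}{c-\lambda},\qquad \operatorname{dom}\mathcal S(\lambda)=\operatorname{dom}A ,$$ and let $\sigma(\mathcal S)$, $\sigma_{\rm p}(\mathcal S)$ and $\rho(\mathcal S)$ be the sets of those $\lambda\in\mathbb C\setminus\{c\}$ for which $0\in\sigma(\mathcal S(\lambda))$, $0\in\sigma_{\rm p}(\mathcal S(\lambda))$ and $0\in\rho(\mathcal S(\lambda))$, respectively; the multiplicity of an eigenvalue $\lambda\in\sigma_{\rm p}(\mathcal S)$ is $\dim\ker\mathcal S(\lambda)$. For a self-adjoint operator $T$ and a Borel set $I\subset\mathbb R$ let $\mathcal L_I(T)$ denote the spectral subspace of $T$ corresponding to $I$, and let $N(A,c)=\dim\mathcal L_{(-\infty,c]}(A)$ be the number of eigenvalues of $A$ that are $\le c$, counted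 with multiplicities. For $u\in\operatorname{dom}A$, $u\neq0$, let $$p_{1,2}(u)=\frac12\left(\frac{(Au,u)}{\|u\|^2}+c\right)\mp\sqrt{\frac14\left(\frac{(Au,u)}{\|u\|^2}-c\right)^2+\frac{\|B^*u\|^2}{\|u\|^2}} .$$ Then $\sigma(\mathcal S)=\sigma_{\rm p}(\mathcal S)$ is real and consists of two finite or infinite eigenvalue sequences $(\lambda_{1,j})_{j=1}^{n_1}\subset(-\infty,c)$ and $(\lambda_{2,j})_{j=1}^{n_2}\subset(c,\infty)$, $n_1,n_2\in\mathbb N_0\cup\{\infty\}$, ordered non-decreasingly and counted with multiplicities. Moreover there are $\alpha_1>c$ and $\kappa_2\in\mathbb N_0$ with $(c,\alpha_1)\subset\rho(\mathcal S)$ and $\dim\mathcal L_{(-\infty,0)}(\mathcal S(\lambda))=\kappa_2$ for all $\lambda\in(c,\alpha_1)$, and $$\lambda_{1,j}=\min_{\substack{\mathcal L\subset\operatorname{dom}A\\ \dim\mathcal L=j}}\ \max_{\substack{u\in\mathcal L\\ u\ne0}}\ p_1(u),\quad j=1,2,\dots,n_1,$$ $$\lambda_{2,j}=\min_{\substack{\mathcal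 L\subset\operatorname{dom}A\\ \dim\mathcal L=j+\kappa_2}}\ \max_{\substack{u\in\mathcal L\\ u\ne0}}\ p_2(u),\quad j=1,2,\dots,n_2 .$$ The index shift satisfies $\kappa_2\le N(A,c)$; in particular $\kappa_2=0$ if $A>c$, i.e. if $(Au,u)>c\|u\|^2$ for all $u\in\operatorname{dom}A$, $u\ne0$. Moreover: i) if $B$ has closed range and $P_A$, $P_B$ are the orthogonal projections onto $\mathcal L_{(-\infty,c]}(A)$ and $\ker B^*$, respectively, then $\kappa_2\le\operatorname{rank}(P_AP_B)\le\min\{N(A,c),\dim\ker B^*\}$; ii) $n_2=\infty$ if and only if $\dim\mathcal H=\infty$; in this case $\lambda_{2,j}\to+\infty$ as $j\to\infty$; iii) $n_1=\infty$ if and only if $\dim\overline{\operatorname{ran}B}=\infty$; in this case $\lambda_{1,j}\to c$ from the left as $j\to\infty$. -/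

import Mathlib

open Set Filter Topology

noncomputable section

namespace RationalPencil

variable {H K : Type*} [NormedAddCommGroup H] [InnerProductSpace ℂ H]
  [NormedAddCommGroup K] [InnerProductSpace ℂ K]

/-! ### Unbounded operators, given as partially defined linear maps -/

/-- The operator `T - z`, with the same domain as `T`. -/
def shift (T : H →ₗ.[ℂ] H) (z : ℂ) : H →ₗ.[ℂ] H where
  domain := T.domain
  toFun := T.toFun - z • T.domain.subtype

/-- `R` is a bounded, everywhere defined, two-sided inverse of the unbounded operator `T`. -/
def IsBoundedInverse (T : H →ₗ.[ℂ] H) (R : H →L[ℂ] H) : Prop :=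
  (∀ x : H, ∃ h : R x ∈ T.domain, T ⟨R x, h⟩ = x) ∧ ∀ u : T.domain, R (T u) = u

/-- The resolvent set: all `z` such that `T - z` has a bounded everywhere defined inverse. -/
def resolventSet (T : H →ₗ.[ℂ] H) : Set ℂ :=
  {z | ∃ R : H →L[ℂ] H, IsBoundedInverse (shift T z) R}

/-- The spectrum, i.e. the complement of the resolvent set. -/
def spec (T : H →ₗ.[ℂ] H) : Set ℂ := (resolventSet T)ᶜ

/-- The kernel `ker (T - z)`, as a subspace of `H`. -/
def eigenspace (T : H →ₗ.[ℂ] H) (z : ℂ) : Submodule ℂ H :=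
  (LinearMap.ker (T.toFun - z • T.domain.subtype)).map T.domain.subtype

/-- The point spectrum, i.e. the set of eigenvalues. -/
def pointSpec (T : H →ₗ.[ℂ] H) : Set ℂ := {z | eigenspace T z ≠ ⊥}

/-- `T` has compact resolvent: `(T - z)⁻¹` is a compact operator for some `z` in the resolvent set
(equivalently, by the resolvent identity, for every such `z`). -/
def HasCompactResolvent (T : H →ₗ.[ℂ] H) : Prop :=
  ∃ (z : ℂ) (R : H →L[ℂ] H), IsBoundedInverse (shift T z) R ∧ IsCompactOperator R

/-- `T` is bounded from below: `(Tu, u) ≥ m ‖u‖²` on the domain, for some real `m`. -/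
def BoundedBelow (T : H →ₗ.[ℂ] H) : Prop :=
  ∃ m : ℝ, ∀ u : T.domain, m * ‖(u : H)‖ ^ 2 ≤ (inner ℂ (u : H) (T u)).re

/-- The spectral subspace `𝓛_I(T)` of a self-adjoint operator `T` with compact resolvent (the only
operators to which it is applied). The spectrum of such an operator consists of eigenvalues, and its
spectral projection for `I` is the orthogonal projection onto the closed linear span of the
eigenvectors for the eigenvalues in `I`. -/
def spectralSubspace (T : H →ₗ.[ℂ] H) (I : Set ℝ) : Submodule ℂ H :=
  (⨆ x ∈ I, eigenspace T (x : ℂ)).topologicalClosure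

instance [CompleteSpace H] (T : H →ₗ.[ℂ] H) (I : Set ℝ) :
    (spectralSubspace T I).HasOrthogonalProjection := by
  unfold spectralSubspace; infer_instance

/-- The dimension of a subspace, in `ℕ ∪ {∞}`. -/
def edim (V : Submodule ℂ H) : ℕ∞ := Cardinal.toENat (Module.rank ℂ V)

/-- `N(T, c) = dim 𝓛_{(-∞, c]}(T)`. -/
def eigenCount (T : H →ₗ.[ℂ] H) (c : ℝ) : ℕ∞ := edim (spectralSubspace T (Iic c))

/-! ### The operator function `S` -/

variable [CompleteSpace H] [CompleteSpace K]

/-- The operator `S(z) = A - z - (c - z)⁻¹ B B*` on the domain of `A`; it is meaningful for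
`z ≠ c`. -/
def schur (A : H →ₗ.[ℂ] H) (B : K →L[ℂ] H) (c : ℝ) (z : ℂ) : H →ₗ.[ℂ] H where
  domain := A.domain
  toFun := A.toFun - z • A.domain.subtype -
    ((c : ℂ) - z)⁻¹ • (B ∘L ContinuousLinearMap.adjoint B).toLinearMap ∘ₗ A.domain.subtype

/-- The resolvent set of the operator function `S`. -/
def schurResolventSet (A : H →ₗ.[ℂ] H) (B : K →L[ℂ] H) (c : ℝ) : Set ℂ :=
  {z | z ≠ c ∧ 0 ∈ resolventSet (schur A B c z)}

/-- The spectrum of the operator function `S`. -/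
def schurSpec (A : H →ₗ.[ℂ] H) (B : K →L[ℂ] H) (c : ℝ) : Set ℂ :=
  {z | z ≠ c ∧ 0 ∈ spec (schur A B c z)}

/-- The point spectrum of the operator function `S`. -/
def schurPointSpec (A : H →ₗ.[ℂ] H) (B : K →L[ℂ] H) (c : ℝ) : Set ℂ :=
  {z | z ≠ c ∧ 0 ∈ pointSpec (schur A B c z)}

/-- `lam 0 ≤ lam 1 ≤ ...` (the terms with index `j < n`, where `n ∈ ℕ ∪ {∞}`) are the eigenvalues
of `S` in `I`, each repeated according to its multiplicity `dim ker S(x)`. -/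
structure IsEigenvalueSequence (A : H →ₗ.[ℂ] H) (B : K →L[ℂ] H) (c : ℝ) (I : Set ℝ)
    (n : ℕ∞) (lam : ℕ → ℝ) : Prop where
  mem : ∀ j : ℕ, (j : ℕ∞) < n → lam j ∈ I
  mono : ∀ i j : ℕ, i ≤ j → (j : ℕ∞) < n → lam i ≤ lam j
  mult : ∀ x ∈ I, {j : ℕ | (j : ℕ∞) < n ∧ lam j = x}.encard =
    edim (eigenspace (schur A B c (x : ℂ)) 0)

/-- `κ` is the index shift on `(c, ∞)`: the dimension of the spectral subspace of `S(x)` for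
`(-∞, 0)`, for all `x` in an interval `(c, α)` contained in the resolvent set of `S`. At most one
`κ` has this property. -/
def IsIndexShift (A : H →ₗ.[ℂ] H) (B : K →L[ℂ] H) (c : ℝ) (κ : ℕ) : Prop :=
  ∃ α : ℝ, c < α ∧ ∀ x ∈ Ioo c α, (x : ℂ) ∈ schurResolventSet A B c ∧
    edim (spectralSubspace (schur A B c (x : ℂ)) (Iio 0)) = κ

/-! ### The functionals and the min-max values -/

/-- The Rayleigh quotient `(Au, u) / ‖u‖²`. -/
def rayleigh (A : H →ₗ.[ℂ] H) (u : A.domain) : ℝ :=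
  (inner ℂ (u : H) (A u)).re / ‖(u : H)‖ ^ 2

/-- The square root in the formula for `p₁` and `p₂`. -/
def rootTerm (A : H →ₗ.[ℂ] H) (B : K →L[ℂ] H) (c : ℝ) (u : A.domain) : ℝ :=
  Real.sqrt (1 / 4 * (rayleigh A u - c) ^ 2 +
    ‖ContinuousLinearMap.adjoint B (u : H)‖ ^ 2 / ‖(u : H)‖ ^ 2)

/-- The functional `p₁` (meaningful for `u ≠ 0`). -/
def p₁ (A : H →ₗ.[ℂ] H) (B : K →L[ℂ] H) (c : ℝ) (u : A.domain) : ℝ :=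
  1 / 2 * (rayleigh A u + c) - rootTerm A B c u

/-- The functional `p₂` (meaningful for `u ≠ 0`). -/
def p₂ (A : H →ₗ.[ℂ] H) (B : K →L[ℂ] H) (c : ℝ) (u : A.domain) : ℝ :=
  1 / 2 * (rayleigh A u + c) + rootTerm A B c u

/-- `m` is the maximum of `p` over the non-zero vectors of `L`. -/
def IsMaxOn₀ (A : H →ₗ.[ℂ] H) (p : A.domain → ℝ) (L : Submodule ℂ A.domain) (m : ℝ) : Prop :=
  IsGreatest (p '' {u | u ∈ L ∧ u ≠ 0}) m

/-- `m = min max p(u)`, the minimum over all subspaces `L ⊆ dom A` with `dim L = k`, the maximum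
over the non-zero `u ∈ L`; all these maxima and the minimum exist. -/
def IsMinMax (A : H →ₗ.[ℂ] H) (p : A.domain → ℝ) (k : ℕ) (m : ℝ) : Prop :=
  (∀ L : Submodule ℂ A.domain, Module.rank ℂ L = k → ∃ x, IsMaxOn₀ A p L x) ∧
    IsLeast {x | ∃ L : Submodule ℂ A.domain, Module.rank ℂ L = k ∧ IsMaxOn₀ A p L x} m

end RationalPencil

end

noncomputable section

namespace RationalPencil

set_option linter.unusedSectionVars false

variable {H K : Type*} [NormedAddCommGroup H] [InnerProductSpace ℂ H]
  [NormedAddCommGroup K] [InnerProductSpace ℂ K]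

/-! ### Operators with compact inverse and their eigenvector bases -/

section

variable {D : Submodule ℂ H}

/-! For real x ≠ c the operator S(x) is A minus a bounded symmetric operator, so it has an
orthonormal eigenbasis whose eigenvalues accumulate only at +∞ (`exists_isEigenbasis_sub`). Let N(x)
be the number of its negative eigenvalues and k(x) = dim ker S(x); `IsCount` records both numbers
with their variational meaning. The whole proof consists in following N as x moves.

For fixed u, (c - x)(S(x)u, u) is ‖u‖² times the quadratic polynomial in x with roots p₁(u) ≤ c ≤
p₂(u) (`form_schurMap_mul`). On either side of c only one root matters: (S(x)u, u) is negative
exactly when p(u) < x and nonpositive exactly when p(u) ≤ x, with p = p₁ on the left and p = p₂ on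
the right. Hence N(x) is the largest dimension of a subspace on which p < x, and N(x) + k(x) is the
largest one for p ≤ x. Since p does not depend on x, N is non-decreasing; compactness of
finite-dimensional spheres gives left continuity, and the spectral gap of S(x) above 0 shows that
the jump at x is exactly k(x) (`IsRootFunctional.isStepFunction`).

The eigenvalues of S in each interval are therefore the jumps of N, repeated by height
(`IsStepFunction.exists_isJumpSequence`), and the min-max formula at a jump is the variational
meaning of N(x) and N(x) + k(x) (`IsRootFunctional.isMinMax`). The index shift is the minimum of N:
it is 0 on the left, where S(x) is nonnegative far out, and κ₂ on the right, attained near c. The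
bounds on κ₂ and the criteria for infinitely many eigenvalues are estimates of N through suitable
test subspaces. Nonreal points are excluded by the imaginary part of (S(z)u, u). -/

theorem exists_compact_inverse_sub [CompleteSpace H] {f : D →ₗ[ℂ] H} {R : H →L[ℂ] H}
    (hR : IsBoundedInverse ⟨D, f⟩ R) (hc : IsCompactOperator R) (G : H →L[ℂ] H)
    (hinj : ∀ u : D, f u - G u = 0 → u = 0) :
    ∃ R' : H →L[ℂ] H, IsBoundedInverse ⟨D, f - G.toLinearMap ∘ₗ D.subtype⟩ R' ∧
      IsCompactOperator R' := by
  have hGR : IsCompactOperator (G ∘L R) := hc.clm_comp G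
  -- Since (f - G)R = 1 - GR with GR compact, the Fredholm alternative applies: if GRv = v, then Rv
  -- lies in the kernel of f - G.
  have h1 : (1 : ℂ) ∈ _root_.resolventSet ℂ (G ∘L R) := by
    refine (hGR.hasEigenvalue_or_mem_resolventSet one_ne_zero).resolve_left fun h => ?_
    obtain ⟨v, hv⟩ := h.exists_hasEigenvector
    have hv1 : G (R v) = v := by simpa using hv.apply_eq_smul
    obtain ⟨hm, hf⟩ := hR.1 v
    have hf' : f ⟨R v, hm⟩ = v := hf
    have := hinj ⟨R v, hm⟩ (by simp [hf', hv1])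
    exact hv.2 (by rw [← hf', this, map_zero])
  rw [spectrum.mem_resolventSet_iff, map_one] at h1
  obtain ⟨W, hW⟩ := h1
  have hW1 : ∀ y, (W⁻¹ : (H →L[ℂ] H)ˣ).1 y - G (R ((W⁻¹ : (H →L[ℂ] H)ˣ).1 y)) = y := by
    intro y
    have := congrArg (fun T : H →L[ℂ] H => T y) W.mul_inv
    rw [hW] at this
    simpa using this
  have hW2 : ∀ y, (W⁻¹ : (H →L[ℂ] H)ˣ).1 (y - G (R y)) = y := by
    intro y
    have := congrArg (fun T : H →L[ℂ] H => T y) W.inv_mul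
    rw [hW] at this
    simpa using this
  -- The inverse of f - G is R(1 - GR)⁻¹, and it is compact because R is.
  refine ⟨R ∘L (W⁻¹ : (H →L[ℂ] H)ˣ).1, ⟨fun y => ?_, fun u => ?_⟩, hc.comp_clm _⟩
  · obtain ⟨hm, hf⟩ := hR.1 ((W⁻¹ : (H →L[ℂ] H)ˣ).1 y)
    refine ⟨hm, ?_⟩
    have hf' : f ⟨_, hm⟩ = _ := hf
    change f ⟨_, hm⟩ - G (R ((W⁻¹ : (H →L[ℂ] H)ˣ).1 y)) = y
    rw [hf', hW1]
  · have h := hR.2 u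
    change R (f u) = u at h
    change R ((W⁻¹ : (H →L[ℂ] H)ˣ).1 (f u - G u)) = u
    conv_lhs => rw [← h]
    rw [hW2, h]

/-- The quadratic form `(f u, u)`. -/
def form (f : D →ₗ[ℂ] H) (u : D) : ℝ := (inner ℂ (u : H) (f u)).re

/-- `b` is an orthonormal basis of eigenvectors of the symmetric operator `f`, and the
corresponding eigenvalues `x` have no accumulation point and are bounded below. -/
structure IsEigenbasis (f : D →ₗ[ℂ] H) {ι : Type} (b : HilbertBasis ι ℂ H) (x : ι → ℝ) :
    Prop where
  symm : ∀ u v : D, inner ℂ (f u) (v : H) = inner ℂ (u : H) (f v)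
  mem : ∀ i, b i ∈ D
  apply : ∀ i, f ⟨b i, mem i⟩ = (x i : ℂ) • b i
  finite : ∀ M : ℝ, {i | x i ≤ M}.Finite

/-- A compact operator has only finitely many orthonormal eigenvectors with eigenvalues
bounded away from zero. -/
theorem finite_of_orthonormal_eigenvectors {R : H →L[ℂ] H} (hc : IsCompactOperator R)
    {ι : Type*} {v : ι → H} (hv : Orthonormal ℂ v) {ν : ι → ℝ}
    (hR : ∀ i, R (v i) = (ν i : ℂ) • v i) {ε : ℝ} (hε : 0 < ε) :
    {i | ε ≤ ν i}.Finite := by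
  by_contra hinf
  have hinf : {i | ε ≤ ν i}.Infinite := hinf
  obtain ⟨C, hC, hC'⟩ := hc.image_closedBall_subset_compact 1
  let g := hinf.natEmbedding
  obtain ⟨y, -, ψ, hψ, hy⟩ := hC.tendsto_subseq (x := fun n => R (v (g n)))
    (fun n => hC' ⟨v (g n), by simp [hv.1], rfl⟩)
  have hcau := hy.cauchySeq
  rw [Metric.cauchySeq_iff'] at hcau
  obtain ⟨n, hn⟩ := hcau ε hε
  have h := hn (n + 1) (Nat.le_succ n)
  have hne : (g (ψ n) : ι) ≠ g (ψ (n + 1)) := fun h =>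
    (hψ (Nat.lt_succ_self n)).ne (g.injective (Subtype.ext h))
  refine absurd h (not_lt.2 ?_)
  simp only [Function.comp, dist_eq_norm]
  -- By orthogonality the images of two distinct vectors are at least √2 ε apart, so no subsequence
  -- of them is Cauchy.
  have hsq : ‖R (v (g (ψ (n + 1)))) - R (v (g (ψ n)))‖ ^ 2 =
      ν (g (ψ (n + 1))) ^ 2 + ν (g (ψ n)) ^ 2 := by
    rw [hR, hR, @norm_sub_sq ℂ, inner_smul_left, inner_smul_right, hv.2 hne.symm, norm_smul,
      norm_smul, hv.1, hv.1]
    simp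
  have h1 := (g (ψ (n + 1))).2
  have h2 := (g (ψ n)).2
  simp only [mem_ofPred_eq] at h1 h2
  refine (sq_le_sq₀ hε.le (norm_nonneg _)).1 ?_
  rw [hsq]
  nlinarith

/-- This is the spectral theorem for the compact symmetric operator R = (f - z)⁻¹: its eigenvectors
for μ are eigenvectors of f for z + 1/μ. The strict bound below by z forces μ > 0, and μ can
accumulate only at 0, so the eigenvalues of f accumulate only at +∞. -/
theorem exists_isEigenbasis [CompleteSpace H] {f : D →ₗ[ℂ] H}
    (hsymm : ∀ u v : D, inner ℂ (f u) (v : H) = inner ℂ (u : H) (f v)) {z : ℝ}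
    (hz : ∀ u : D, u ≠ 0 → z * ‖(u : H)‖ ^ 2 < form f u) {R : H →L[ℂ] H}
    (hR : IsBoundedInverse ⟨D, f - (z : ℂ) • D.subtype⟩ R) (hc : IsCompactOperator R) :
    ∃ (ι : Type) (b : HilbertBasis ι ℂ H) (x : ι → ℝ), IsEigenbasis f b x := by
  have hfR : ∀ y, ∃ h : R y ∈ D, f ⟨R y, h⟩ = y + (z : ℂ) • R y := by
    intro y
    obtain ⟨hm, hf⟩ := hR.1 y
    change f ⟨R y, hm⟩ - (z : ℂ) • R y = y at hf
    exact ⟨hm, sub_eq_iff_eq_add.1 hf⟩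
  have hRsymm : (R : H →ₗ[ℂ] H).IsSymmetric := by
    intro y w
    obtain ⟨hy, hy'⟩ := hfR y
    obtain ⟨hw, hw'⟩ := hfR w
    have := hsymm ⟨R y, hy⟩ ⟨R w, hw⟩
    rw [hy', hw', inner_add_left, inner_add_right, inner_smul_left, inner_smul_right] at this
    simpa using this.symm
  have hinj : ∀ y, R y = 0 → y = 0 := by
    intro y hy
    obtain ⟨hm, hf⟩ := hfR y
    have : (⟨R y, hm⟩ : D) = 0 := Subtype.ext hy
    rw [this, hy] at hf
    simpa using hf.symm
  -- Compactness of R settles μ ≠ 0; the kernel is trivial because R is injective.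
  have hfin : ∀ μ : ℂ, FiniteDimensional ℂ (Module.End.eigenspace (R : H →ₗ[ℂ] H) μ) := by
    intro μ
    by_cases hμ : μ = 0
    · have : Module.End.eigenspace (R : H →ₗ[ℂ] H) μ = ⊥ := by
        rw [eq_bot_iff]
        intro y hy
        rw [Module.End.mem_eigenspace_iff, hμ, zero_smul] at hy
        exact hinj y hy
      rw [this]
      infer_instance
    · exact ContinuousLinearMap.finite_dimensional_eigenspace hc μ hμ
  have hort := hRsymm.orthogonalFamily_eigenspaces
  let v : (Σ μ : ℂ, Fin (Module.finrank ℂ (Module.End.eigenspace (R : H →ₗ[ℂ] H) μ))) → H :=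
    fun a => (stdOrthonormalBasis ℂ (Module.End.eigenspace (R : H →ₗ[ℂ] H) a.1) a.2 : H)
  have hv : Orthonormal ℂ v := hort.orthonormal_sigma_orthonormal
    (fun μ => (stdOrthonormalBasis ℂ (Module.End.eigenspace (R : H →ₗ[ℂ] H) μ)).orthonormal)
  have hspan : (Submodule.span ℂ (Set.range v))ᗮ = ⊥ := by
    rw [eq_bot_iff, ← ContinuousLinearMap.orthogonalComplement_iSup_eigenspaces_eq_bot hc hRsymm]
    refine Submodule.orthogonal_le (iSup_le fun μ => ?_)
    have h1 := (stdOrthonormalBasis ℂ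
      (Module.End.eigenspace (R : H →ₗ[ℂ] H) μ)).toBasis.span_eq
    have h2 := congrArg (Submodule.map (Submodule.subtype _)) h1
    rw [Submodule.map_top, Submodule.range_subtype, Submodule.map_span] at h2
    rw [← h2]
    refine Submodule.span_mono ?_
    rintro _ ⟨_, ⟨k, rfl⟩, rfl⟩
    exact ⟨⟨μ, k⟩, by simp [v]⟩
  let b := HilbertBasis.mkOfOrthogonalEqBot hv hspan
  have hb : ⇑b = v := HilbertBasis.coe_mkOfOrthogonalEqBot hv hspan
  have hRv : ∀ a, R (v a) = a.1 • v a := fun a =>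
    Module.End.mem_eigenspace_iff.1
      (stdOrthonormalBasis ℂ (Module.End.eigenspace (R : H →ₗ[ℂ] H) a.1) a.2).2
  have hne : ∀ a, v a ≠ 0 := hv.ne_zero
  have hreal : ∀ a : Σ μ : ℂ, Fin (Module.finrank ℂ
      (Module.End.eigenspace (R : H →ₗ[ℂ] H) μ)), ((a.1.re : ℝ) : ℂ) = a.1 := by
    intro a
    refine Complex.conj_eq_iff_re.1 (hRsymm.conj_eigenvalue_eq_self (μ := a.1) ?_)
    exact Module.End.hasEigenvalue_of_hasEigenvector
      (x := v a) ⟨Module.End.mem_eigenspace_iff.2 (hRv a), hne a⟩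
  have hkey : ∀ a, ∃ h : v a ∈ D, 0 < a.1.re ∧
      f ⟨v a, h⟩ = ((z + a.1.re⁻¹ : ℝ) : ℂ) • v a := by
    intro a
    have h0 : a.1 ≠ 0 := fun h => hne a (hinj _ (by rw [hRv, h, zero_smul]))
    obtain ⟨hm, hf⟩ := hfR (v a)
    have hmem : v a ∈ D := by
      rw [hRv] at hm
      simpa [smul_smul, h0] using D.smul_mem a.1⁻¹ hm
    have hval : f ⟨v a, hmem⟩ = ((z + a.1.re⁻¹ : ℝ) : ℂ) • v a := by
      have h1 : (⟨R (v a), hm⟩ : D) = a.1 • ⟨v a, hmem⟩ := Subtype.ext (hRv a)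
      rw [h1, map_smul, hRv] at hf
      have h2 := congrArg (fun y => a.1⁻¹ • y) hf
      simp only [smul_smul, smul_add, inv_mul_cancel₀ h0, one_smul] at h2
      rw [h2, ← add_smul]
      congr 1
      push_cast
      rw [hreal a]
      field_simp
      ring
    refine ⟨hmem, ?_, hval⟩
    have h3 := hz ⟨v a, hmem⟩ (fun h => hne a (congrArg Subtype.val h))
    rw [form, hval, inner_smul_right, inner_self_eq_norm_sq_to_K, hv.1] at h3
    simp at h3
    exact h3
  refine ⟨_, b, fun a => z + a.1.re⁻¹, hsymm, fun a => ?_, fun a => ?_, fun M => ?_⟩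
  · rw [hb]; exact (hkey a).1
  · have := (hkey a).2.2
    simp only [hb]
    exact this
  -- z + 1/μ ≤ M means 1/μ ≤ M - z; the maximum with 1 keeps the threshold for μ positive.
  · have hM : 0 < (max (M - z) 1)⁻¹ := by positivity
    refine (finite_of_orthonormal_eigenvectors hc hv (ν := fun a => a.1.re)
      (fun a => by rw [hreal, hRv]) hM).subset fun a ha => ?_
    obtain ⟨-, hpos, -⟩ := hkey a
    simp only [mem_ofPred_eq] at ha ⊢
    rw [inv_le_comm₀ (by positivity) hpos]
    exact le_max_of_le_left (by linarith)

end

/-! ### Counting eigenvalues -/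

section

variable {D : Submodule ℂ H} {f : D →ₗ[ℂ] H} {ι : Type} {b : HilbertBasis ι ℂ H} {x : ι → ℝ}

theorem hasSum_norm_inner_sq (b : HilbertBasis ι ℂ H) (u : H) :
    HasSum (fun i => ‖inner ℂ (b i) u‖ ^ 2) (‖u‖ ^ 2) := by
  have h := Complex.hasSum_re (b.hasSum_inner_mul_inner u u)
  convert h using 1
  · ext i
    rw [← inner_conj_symm u, ← Complex.normSq_eq_conj_mul_self, Complex.ofReal_re,
      Complex.normSq_eq_norm_sq]
  · rw [inner_self_eq_norm_sq_to_K]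
    norm_cast

theorem mem_span_of_inner_eq_zero (b : HilbertBasis ι ℂ H) {s : Set ι} (hs : s.Finite) {u : H}
    (hu : ∀ i ∉ s, inner ℂ (b i) u = 0) : u ∈ Submodule.span ℂ (b '' s) := by
  have h1 := b.hasSum_repr u
  have h2 : HasSum (fun i => b.repr u i • b i) (∑ i ∈ hs.toFinset, b.repr u i • b i) := by
    refine hasSum_sum_of_ne_finset_zero fun i hi => ?_
    rw [b.repr_apply_apply, hu i (by simpa using hi), zero_smul]
  rw [h1.unique h2]
  refine Submodule.sum_mem _ fun i hi => Submodule.smul_mem _ _ (Submodule.subset_span ?_)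
  exact ⟨i, by simpa using hi, rfl⟩

theorem inner_eq_zero_of_mem_span (b : HilbertBasis ι ℂ H) {s : Set ι} {u : H}
    (hu : u ∈ Submodule.span ℂ (b '' s)) {i : ι} (hi : i ∉ s) : inner ℂ (b i) u = 0 := by
  induction hu using Submodule.span_induction with
  | mem v hv =>
    obtain ⟨j, hj, rfl⟩ := hv
    exact b.orthonormal.2 (fun h => hi (h ▸ hj))
  | zero => simp
  | add v w _ _ hv hw => rw [inner_add_right, hv, hw, add_zero]
  | smul a v _ hv => rw [inner_smul_right, hv, mul_zero]

theorem rank_span_image (b : HilbertBasis ι ℂ H) {s : Set ι} (hs : s.Finite) :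
    Module.rank ℂ (Submodule.span ℂ (b '' s)) = s.ncard := by
  have hli : LinearIndependent ℂ (fun i : s => b i) :=
    b.orthonormal.linearIndependent.comp _ Subtype.val_injective
  have h := rank_span hli
  rw [← image_eq_range (⇑b)] at h
  rw [h, ← Set.cast_ncard (hs.image b), 
    ncard_image_of_injective s b.orthonormal.linearIndependent.injective]

theorem edim_span_image (b : HilbertBasis ι ℂ H) {s : Set ι} (hs : s.Finite) :
    edim (Submodule.span ℂ (b '' s)) = (s.ncard : ℕ∞) := by
  rw [edim, rank_span_image b hs]
  simp

/-- A subspace whose dimension exceeds `#s` contains a non-zero vector orthogonal to the basis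
vectors with index in `s`. -/
theorem exists_inner_eq_zero (b : HilbertBasis ι ℂ H) {s : Set ι} (hs : s.Finite)
    {L : Submodule ℂ D} (hL : (s.ncard : Cardinal) < Module.rank ℂ L) :
    ∃ u ∈ L, u ≠ 0 ∧ ∀ i ∈ s, inner ℂ (b i) (u : H) = 0 := by
  have := hs.fintype
  let φ : L →ₗ[ℂ] (s → ℂ) := LinearMap.pi fun i : s =>
    (innerₛₗ ℂ (b i)) ∘ₗ D.subtype ∘ₗ L.subtype
  -- A dimension count; the lifts only reconcile the universes of `H` and `ι`.
  have hφ : ¬ Function.Injective φ := by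
    intro h
    have h1 := LinearMap.lift_rank_le_of_injective φ h
    rw [rank_fun', ← Set.toFinset_card, ← Set.ncard_eq_toFinset_card'] at h1
    simp only [Cardinal.lift_natCast] at h1
    rw [← Cardinal.lift_natCast.{0}] at h1
    have h2 := Cardinal.lift_lt.{_, 0}.2 hL
    rw [Cardinal.lift_natCast] at h2
    exact absurd h1 (not_le.2 (by simpa using h2))
  rw [← LinearMap.ker_eq_bot, Submodule.eq_bot_iff] at hφ
  push Not at hφ
  obtain ⟨u, hu, hu0⟩ := hφ
  refine ⟨u, u.2, fun h => hu0 (Subtype.ext h), fun i hi => ?_⟩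
  exact congrFun (LinearMap.mem_ker.1 hu) ⟨i, hi⟩

namespace IsEigenbasis

theorem inner_apply (h : IsEigenbasis f b x) (i : ι) (u : D) :
    inner ℂ (b i) (f u) = (x i : ℂ) * inner ℂ (b i) (u : H) := by
  rw [← h.symm ⟨b i, h.mem i⟩ u, h.apply, inner_smul_left, Complex.conj_ofReal]

theorem hasSum_form (h : IsEigenbasis f b x) (u : D) :
    HasSum (fun i => x i * ‖inner ℂ (b i) (u : H)‖ ^ 2) (form f u) := by
  have h1 := Complex.hasSum_re (b.hasSum_inner_mul_inner (u : H) (f u))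
  rw [form]
  convert h1 using 1
  ext i
  rw [h.inner_apply, mul_left_comm, ← inner_conj_symm (u : H), ← Complex.normSq_eq_conj_mul_self,
    ← Complex.ofReal_mul, Complex.ofReal_re, Complex.normSq_eq_norm_sq]

theorem le_form (h : IsEigenbasis f b x) {y : ℝ} {u : D}
    (hu : ∀ i, inner ℂ (b i) (u : H) = 0 ∨ y ≤ x i) : y * ‖(u : H)‖ ^ 2 ≤ form f u := by
  refine hasSum_le (fun i => ?_) ((hasSum_norm_inner_sq b (u : H)).mul_left y) (h.hasSum_form u)
  rcases hu i with h0 | h0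
  · simp [h0]
  · gcongr

theorem form_le (h : IsEigenbasis f b x) {y : ℝ} {u : D}
    (hu : ∀ i, inner ℂ (b i) (u : H) = 0 ∨ x i ≤ y) : form f u ≤ y * ‖(u : H)‖ ^ 2 := by
  refine hasSum_le (fun i => ?_) (h.hasSum_form u) ((hasSum_norm_inner_sq b (u : H)).mul_left y)
  rcases hu i with h0 | h0
  · simp [h0]
  · gcongr

theorem finite_of_le (h : IsEigenbasis f b x) {I : Set ℝ} {M : ℝ} (hI : ∀ t ∈ I, t ≤ M) :
    {i | x i ∈ I}.Finite :=
  (h.finite M).subset fun _ hi => hI _ hi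

theorem eigenspace_eq (h : IsEigenbasis f b x) (y : ℝ) :
    eigenspace ⟨D, f⟩ (y : ℂ) = Submodule.span ℂ (b '' {i | x i = y}) := by
  apply le_antisymm
  · rintro _ ⟨u, hu, rfl⟩
    have hu' : f u = (y : ℂ) • (u : H) := sub_eq_zero.1 (LinearMap.mem_ker.1 hu)
    refine mem_span_of_inner_eq_zero b (h.finite_of_le (I := {y}) (M := y) (by simp)) ?_
    intro i hi
    have h1 := h.inner_apply i u
    rw [hu', inner_smul_right] at h1
    have h2 : ((x i - y : ℝ) : ℂ) * inner ℂ (b i) (u : H) = 0 := by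
      push_cast
      rw [sub_mul, h1, sub_self]
    refine (mul_eq_zero.1 h2).resolve_left ?_
    rw [Complex.ofReal_eq_zero, sub_eq_zero]
    exact hi
  · rw [Submodule.span_le]
    rintro _ ⟨i, hi, rfl⟩
    refine ⟨⟨b i, h.mem i⟩, LinearMap.mem_ker.2 ?_, rfl⟩
    change f ⟨b i, h.mem i⟩ - (y : ℂ) • b i = 0
    rw [h.apply, show x i = y from hi, sub_self]

/-- Only finitely many basis eigenvalues lie in a set bounded above, so the span is
finite-dimensional and taking the closure adds nothing. -/
theorem spectralSubspace_eq (h : IsEigenbasis f b x) {I : Set ℝ} {M : ℝ} (hI : ∀ t ∈ I, t ≤ M) :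
    spectralSubspace ⟨D, f⟩ I = Submodule.span ℂ (b '' {i | x i ∈ I}) := by
  have h1 : (⨆ t ∈ I, eigenspace ⟨D, f⟩ (t : ℂ)) = Submodule.span ℂ (b '' {i | x i ∈ I}) := by
    simp only [h.eigenspace_eq]
    rw [← Submodule.span_iUnion₂]
    congr 1
    ext v
    simp only [mem_iUnion, mem_image, mem_ofPred_eq]
    constructor
    · rintro ⟨t, ht, i, rfl, rfl⟩
      exact ⟨i, ht, rfl⟩
    · rintro ⟨i, hi, rfl⟩
      exact ⟨x i, hi, i, rfl, rfl⟩
  have : FiniteDimensional ℂ (Submodule.span ℂ (b '' {i | x i ∈ I})) :=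
    FiniteDimensional.span_of_finite ℂ ((h.finite_of_le hI).image b)
  rw [spectralSubspace, h1]
  exact (Submodule.closed_of_finiteDimensional _).submodule_topologicalClosure_eq

theorem exists_gap (h : IsEigenbasis f b x) (y : ℝ) : ∃ δ > 0, ∀ i, x i ≤ y ∨ y + δ ≤ x i := by
  have hfin : {i | y < x i ∧ x i ≤ y + 1}.Finite := (h.finite (y + 1)).subset fun i hi => hi.2
  rcases eq_empty_or_nonempty {i | y < x i ∧ x i ≤ y + 1} with he | hne
  · refine ⟨1, one_pos, fun i => ?_⟩
    by_contra! hc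
    exact (he ▸ (⟨hc.1, hc.2.le⟩ : i ∈ {i | y < x i ∧ x i ≤ y + 1}) : i ∈ (∅ : Set ι))
  · obtain ⟨j, hj, hmin⟩ := exists_min_image _ x hfin hne
    refine ⟨x j - y, sub_pos.2 hj.1, fun i => ?_⟩
    by_contra! hc
    have := hmin i ⟨hc.1, by linarith [hj.2]⟩
    linarith

theorem exists_le_form (h : IsEigenbasis f b x) {y : ℝ} {s : Set ι} (hs : s.Finite)
    (hy : ∀ i ∉ s, y ≤ x i) {L : Submodule ℂ D} (hL : (s.ncard : Cardinal) < Module.rank ℂ L) :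
    ∃ u ∈ L, u ≠ 0 ∧ y * ‖(u : H)‖ ^ 2 ≤ form f u := by
  obtain ⟨u, huL, hu0, hu⟩ := exists_inner_eq_zero b hs hL
  refine ⟨u, huL, hu0, h.le_form fun i => ?_⟩
  by_cases hi : i ∈ s
  · exact .inl (hu i hi)
  · exact .inr (hy i hi)

theorem exists_submodule (h : IsEigenbasis f b x) {s : Set ι} (hs : s.Finite) :
    ∃ L : Submodule ℂ D, Module.rank ℂ L = s.ncard ∧
      L.map D.subtype = Submodule.span ℂ (b '' s) := by
  have hle : Submodule.span ℂ (b '' s) ≤ D := by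
    rw [Submodule.span_le]
    rintro _ ⟨i, -, rfl⟩
    exact h.mem i
  refine ⟨(Submodule.span ℂ (b '' s)).comap D.subtype, ?_, ?_⟩
  · rw [(Submodule.comapSubtypeEquivOfLe hle).rank_eq, rank_span_image b hs]
  · rw [Submodule.map_comap_subtype, inf_eq_right.2 hle]

end IsEigenbasis

/-- The number `N` of eigenvalues below `y` and the multiplicity `k` of the eigenvalue `y`, with
their variational characterisations. -/
structure IsCount (f : D →ₗ[ℂ] H) (y : ℝ) (N k : ℕ) : Prop where
  edim_Iio : edim (spectralSubspace ⟨D, f⟩ (Iio y)) = N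
  edim_Iic : edim (spectralSubspace ⟨D, f⟩ (Iic y)) = (N + k : ℕ)
  edim_eigenspace : edim (eigenspace ⟨D, f⟩ (y : ℂ)) = k
  exists_lt : ∃ L : Submodule ℂ D, Module.rank ℂ L = N ∧
    ∀ u ∈ L, u ≠ 0 → form f u < y * ‖(u : H)‖ ^ 2
  exists_le : ∃ L : Submodule ℂ D, Module.rank ℂ L = (N + k : ℕ) ∧
    ∀ u ∈ L, form f u ≤ y * ‖(u : H)‖ ^ 2
  le_of_lt_rank : ∀ L : Submodule ℂ D, (N : Cardinal) < Module.rank ℂ L →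
    ∃ u ∈ L, u ≠ 0 ∧ y * ‖(u : H)‖ ^ 2 ≤ form f u
  gap_of_lt_rank : ∃ δ > 0, ∀ L : Submodule ℂ D, ((N + k : ℕ) : Cardinal) < Module.rank ℂ L →
    ∃ u ∈ L, u ≠ 0 ∧ (y + δ) * ‖(u : H)‖ ^ 2 ≤ form f u

/-- The spans of the eigenvectors below y, and up to y, serve as trial subspaces. Conversely, a
subspace of larger dimension meets the orthogonal complement of such a span, where the form is
bounded below by the next eigenvalue. -/
theorem IsEigenbasis.exists_isCount (h : IsEigenbasis f b x) (y : ℝ) :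
    ∃ N k : ℕ, IsCount f y N k := by
  have hlt : {i | x i < y}.Finite := h.finite_of_le (I := Iio y) (M := y) fun t ht => le_of_lt ht
  have heq : {i | x i = y}.Finite := h.finite_of_le (I := {y}) (M := y) (by simp)
  have hcard : {i | x i ≤ y}.ncard = {i | x i < y}.ncard + {i | x i = y}.ncard := by
    rw [← ncard_union_eq _ hlt heq]
    · congr 1
      ext i
      simp only [mem_union, mem_ofPred_eq]
      exact le_iff_lt_or_eq
    · exact disjoint_left.2 fun i (hi : x i < y) (hi' : x i = y) => hi.ne hi'
  have h1 := h.spectralSubspace_eq (I := Iio y) (M := y) fun t ht => le_of_lt ht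
  have h2 := h.spectralSubspace_eq (I := Iic y) (M := y) fun t ht => ht
  refine ⟨{i | x i < y}.ncard, {i | x i = y}.ncard, ?_, ?_, ?_, ?_, ?_, ?_, ?_⟩
  · rw [h1]
    exact edim_span_image b hlt
  · rw [h2, ← hcard]
    exact edim_span_image b (h.finite y)
  · rw [h.eigenspace_eq]
    exact edim_span_image b heq
  · obtain ⟨L, hL, hmap⟩ := h.exists_submodule hlt
    refine ⟨L, hL, fun u hu hu0 => ?_⟩
    have hu' : (u : H) ∈ Submodule.span ℂ (b '' {i | x i < y}) := by
      rw [← hmap]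
      exact ⟨u, hu, rfl⟩
    have hne : {i | x i < y}.Nonempty := by
      by_contra! he
      rw [he] at hu'
      simp only [image_empty, Submodule.span_empty, Submodule.mem_bot] at hu'
      exact hu0 (Subtype.ext hu')
    -- The largest of the finitely many eigenvalues below y is still strictly below y, hence the
    -- strict inequality.
    obtain ⟨j, hj, hmax⟩ := exists_max_image _ x hlt hne
    have hpos : 0 < ‖(u : H)‖ := norm_pos_iff.2 fun h => hu0 (Subtype.ext h)
    calc form f u ≤ x j * ‖(u : H)‖ ^ 2 := h.form_le fun i => by
          by_cases hi : x i < y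
          · exact .inr (hmax i hi)
          · exact .inl (inner_eq_zero_of_mem_span b hu' hi)
      _ < y * ‖(u : H)‖ ^ 2 := by
          have : x j < y := hj
          gcongr
  · obtain ⟨L, hL, hmap⟩ := h.exists_submodule (h.finite y)
    refine ⟨L, by rw [hL, hcard], fun u hu => h.form_le fun i => ?_⟩
    have hu' : (u : H) ∈ Submodule.span ℂ (b '' {i | x i ≤ y}) := by
      rw [← hmap]
      exact ⟨u, hu, rfl⟩
    by_cases hi : x i ≤ y
    · exact .inr hi
    · exact .inl (inner_eq_zero_of_mem_span b hu' hi)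
  · exact fun L hL => h.exists_le_form hlt (fun i hi => not_lt.1 hi) hL
  · obtain ⟨δ, hδ, hgap⟩ := h.exists_gap y
    refine ⟨δ, hδ, fun L hL => ?_⟩
    rw [← hcard] at hL
    exact h.exists_le_form (h.finite y) (fun i hi => (hgap i).resolve_left hi) hL

end

/-! ### Jumps of integer-valued step functions -/

section

/-- `N` is a left-continuous integer-valued step function on the interval `I` with jumps `k` and
minimum `κ`. -/
structure IsStepFunction (I : Set ℝ) (N k : ℝ → ℕ) (κ : ℕ) : Prop where
  ordConnected : I.OrdConnected
  add_le : ∀ x ∈ I, ∀ y ∈ I, x < y → N x + k x ≤ N y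
  right : ∀ x ∈ I, ∃ y ∈ I, x < y ∧ N y ≤ N x + k x
  left : ∀ x ∈ I, ∃ y ∈ I, y < x ∧ N x ≤ N y
  min : ∀ x ∈ I, κ ≤ N x
  attained : ∃ x ∈ I, N x = κ

/-- The sequence of jumps of a step function, repeated according to their heights. -/
structure IsJumpSequence (I : Set ℝ) (N k : ℝ → ℕ) (κ : ℕ) (n : ℕ∞) (lam : ℕ → ℝ) : Prop where
  lt_iff : ∀ j : ℕ, (j : ℕ∞) < n ↔ ∃ x ∈ I, j + κ < N x
  mem : ∀ j : ℕ, (j : ℕ∞) < n → lam j ∈ I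
  eq_iff : ∀ x ∈ I, ∀ j : ℕ, ((j : ℕ∞) < n ∧ lam j = x) ↔ N x ≤ j + κ ∧ j + κ < N x + k x

variable {I : Set ℝ} {N k : ℝ → ℕ} {κ : ℕ}

theorem IsStepFunction.mono (h : IsStepFunction I N k κ) {x y : ℝ} (hx : x ∈ I) (hy : y ∈ I)
    (hxy : x ≤ y) : N x ≤ N y := by
  rcases hxy.eq_or_lt with rfl | hlt
  · rfl
  · exact (Nat.le_add_right _ _).trans (h.add_le x hx y hy hlt)

/-- Jump number j is the infimum of the points where N exceeds j + κ. Left continuity gives N ≤ j +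
κ there, and `right` gives N + k > j + κ. A point with N = κ keeps the infimum inside I. For j ≥ n
the infimum is over the empty set and carries no meaning. -/
theorem IsStepFunction.exists_isJumpSequence (h : IsStepFunction I N k κ) :
    ∃ (n : ℕ∞) (lam : ℕ → ℝ), IsJumpSequence I N k κ n lam := by
  have hn : ∀ j : ℕ, (j : ℕ∞) < (⨆ x ∈ I, ((N x - κ : ℕ) : ℕ∞)) ↔ ∃ x ∈ I, j + κ < N x := by
    intro j
    simp only [lt_iSup_iff, Nat.cast_lt, exists_prop, Nat.lt_sub_iff_add_lt]
  let S : ℕ → Set ℝ := fun j => {x | x ∈ I ∧ j + κ < N x}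
  obtain ⟨x₀, hx₀, hN₀⟩ := h.attained
  have hlow : ∀ j, ∀ x ∈ S j, x₀ ≤ x := by
    intro j x hx
    by_contra! hlt
    have := h.mono hx.1 hx₀ hlt.le
    have := hx.2
    omega
  have hbdd : ∀ j, BddBelow (S j) := fun j => ⟨x₀, hlow j⟩
  have hkey : ∀ j : ℕ, (∃ x ∈ I, j + κ < N x) → sInf (S j) ∈ I ∧ N (sInf (S j)) ≤ j + κ ∧
      j + κ < N (sInf (S j)) + k (sInf (S j)) := by
    rintro j ⟨x, hx, hjx⟩
    have hne : (S j).Nonempty := ⟨x, hx, hjx⟩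
    have hmem : sInf (S j) ∈ I :=
      h.ordConnected.out hx₀ hx ⟨le_csInf hne (hlow j), csInf_le (hbdd j) ⟨hx, hjx⟩⟩
    refine ⟨hmem, ?_, ?_⟩
    · by_contra! hlt
      obtain ⟨y, hy, hyl, hN⟩ := h.left _ hmem
      exact absurd (csInf_le (hbdd j) (show y ∈ S j from ⟨hy, hlt.trans_le hN⟩)) (not_le.2 hyl)
    · obtain ⟨y, hy, hyl, hN⟩ := h.right _ hmem
      obtain ⟨s, hs, hsy⟩ := exists_lt_of_csInf_lt hne hyl
      have := h.mono hs.1 hy hsy.le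
      have := hs.2
      omega
  refine ⟨_, fun j => sInf (S j), hn, fun j hj => (hkey j ((hn j).1 hj)).1, fun x hx j => ?_⟩
  constructor
  · rintro ⟨hj, rfl⟩
    exact (hkey j ((hn j).1 hj)).2
  · rintro ⟨h1, h2⟩
    obtain ⟨y, hy, hxy, -⟩ := h.right x hx
    have h3 : ∃ x ∈ I, j + κ < N x := ⟨y, hy, h2.trans_le (h.add_le x hx y hy hxy)⟩
    refine ⟨(hn j).2 h3, ?_⟩
    obtain ⟨hmem, h4, h5⟩ := hkey j h3
    rcases lt_trichotomy (sInf (S j)) x with hlt | heq | hgt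
    · have := h.add_le _ hmem x hx hlt
      omega
    · exact heq
    · have := h.add_le x hx _ hmem hgt
      omega

namespace IsJumpSequence

variable {n : ℕ∞} {lam : ℕ → ℝ}

theorem bounds (hl : IsJumpSequence I N k κ n lam) {j : ℕ} (hj : (j : ℕ∞) < n) :
    N (lam j) ≤ j + κ ∧ j + κ < N (lam j) + k (lam j) :=
  (hl.eq_iff _ (hl.mem j hj) j).1 ⟨hj, rfl⟩

theorem mono (h : IsStepFunction I N k κ) (hl : IsJumpSequence I N k κ n lam) {i j : ℕ}
    (hij : i ≤ j) (hj : (j : ℕ∞) < n) : lam i ≤ lam j := by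
  have hi : (i : ℕ∞) < n := lt_of_le_of_lt (by exact_mod_cast hij) hj
  by_contra! hlt
  have h1 := h.add_le _ (hl.mem j hj) _ (hl.mem i hi) hlt
  have h2 := hl.bounds hi
  have h3 := hl.bounds hj
  omega

theorem encard_eq (h : IsStepFunction I N k κ) (hl : IsJumpSequence I N k κ n lam) {x : ℝ}
    (hx : x ∈ I) : {j : ℕ | (j : ℕ∞) < n ∧ lam j = x}.encard = k x := by
  -- The truncated subtractions are genuine because κ ≤ N x.
  have h1 : {j : ℕ | (j : ℕ∞) < n ∧ lam j = x} = Finset.Ico (N x - κ) (N x + k x - κ) := by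
    ext j
    have := h.min x hx
    simp only [mem_ofPred_eq, hl.eq_iff x hx, Finset.coe_Ico, mem_Ico]
    omega
  rw [h1, encard_coe_eq_coe_finsetCard, Nat.card_Ico]
  have := h.min x hx
  congr 1
  omega

theorem eventually_le (h : IsStepFunction I N k κ) (hl : IsJumpSequence I N k κ n lam)
    (hn : n = ⊤) {x : ℝ} (hx : x ∈ I) : ∀ᶠ j in atTop, x ≤ lam j := by
  filter_upwards [eventually_ge_atTop (N x)] with j hj
  have hj' : (j : ℕ∞) < n := hn ▸ ENat.natCast_lt_top j
  by_contra! hlt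
  have h1 := h.add_le _ (hl.mem j hj') x hx hlt
  have h2 := hl.bounds hj'
  omega

theorem eq_top_iff (hl : IsJumpSequence I N k κ n lam) :
    n = ⊤ ↔ ∀ m : ℕ, ∃ x ∈ I, m ≤ N x := by
  rw [ENat.eq_top_iff_forall_gt]
  constructor
  · intro h m
    obtain ⟨x, hx, hlt⟩ := (hl.lt_iff m).1 (h m)
    exact ⟨x, hx, by omega⟩
  · intro h m
    obtain ⟨x, hx, hle⟩ := h (m + κ + 1)
    exact (hl.lt_iff m).2 ⟨x, hx, by omega⟩

end IsJumpSequence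

end

/-! ### The functionals `p₁` and `p₂` -/

section

variable [CompleteSpace H] [CompleteSpace K]

/-- The action of `S(z)` as a linear map on the domain of `A`. -/
def schurMap (A : H →ₗ.[ℂ] H) (B : K →L[ℂ] H) (c : ℝ) (z : ℂ) : A.domain →ₗ[ℂ] H :=
  A.toFun - z • A.domain.subtype -
    ((c : ℂ) - z)⁻¹ • (B ∘L ContinuousLinearMap.adjoint B).toLinearMap ∘ₗ A.domain.subtype

theorem schur_eq (A : H →ₗ.[ℂ] H) (B : K →L[ℂ] H) (c : ℝ) (z : ℂ) :
    schur A B c z = ⟨A.domain, schurMap A B c z⟩ := rfl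

variable {A : H →ₗ.[ℂ] H} {B : K →L[ℂ] H} {c : ℝ}

theorem inner_schurMap (z : ℂ) (u : A.domain) :
    inner ℂ (u : H) (schurMap A B c z u) = inner ℂ (u : H) (A u) - z * (‖(u : H)‖ ^ 2 : ℝ) -
      ((c : ℂ) - z)⁻¹ * (‖ContinuousLinearMap.adjoint B (u : H)‖ ^ 2 : ℝ) := by
  change inner ℂ (u : H) (A u - z • (u : H) -
    ((c : ℂ) - z)⁻¹ • B (ContinuousLinearMap.adjoint B (u : H))) = _
  rw [inner_sub_right, inner_sub_right, inner_smul_right, inner_smul_right,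
    inner_self_eq_norm_sq_to_K, ← ContinuousLinearMap.adjoint_inner_left,
    inner_self_eq_norm_sq_to_K]
  norm_cast

theorem form_schurMap (x : ℝ) (u : A.domain) :
    form (schurMap A B c x) u = form A.toFun u - x * ‖(u : H)‖ ^ 2 -
      (c - x)⁻¹ * ‖ContinuousLinearMap.adjoint B (u : H)‖ ^ 2 := by
  rw [form, inner_schurMap, ← Complex.ofReal_sub, ← Complex.ofReal_inv, ← Complex.ofReal_mul,
    ← Complex.ofReal_mul, Complex.sub_re, Complex.sub_re, Complex.ofReal_re, Complex.ofReal_re]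
  rfl

theorem norm_coe_pos {D : Submodule ℂ H} {u : D} (hu : u ≠ 0) : 0 < ‖(u : H)‖ :=
  norm_pos_iff.2 fun h => hu (Subtype.ext h)

theorem abs_le_rootTerm (u : A.domain) : |(rayleigh A u - c) / 2| ≤ rootTerm A B c u := by
  rw [rootTerm, ← Real.sqrt_sq_eq_abs]
  refine Real.sqrt_le_sqrt ?_
  have : 0 ≤ ‖ContinuousLinearMap.adjoint B (u : H)‖ ^ 2 / ‖(u : H)‖ ^ 2 := by positivity
  linarith

theorem p₁_le (u : A.domain) : p₁ A B c u ≤ c := by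
  have := (abs_le.1 (abs_le_rootTerm (B := B) (c := c) u)).2
  rw [p₁]
  linarith

theorem le_p₂ (u : A.domain) : c ≤ p₂ A B c u := by
  have := (abs_le.1 (abs_le_rootTerm (B := B) (c := c) u)).1
  rw [p₂]
  linarith

theorem p₁_lt {u : A.domain} (hu : u ≠ 0) (hB : ContinuousLinearMap.adjoint B (u : H) ≠ 0) :
    p₁ A B c u < c := by
  have h1 : |(rayleigh A u - c) / 2| < rootTerm A B c u := by
    rw [rootTerm, ← Real.sqrt_sq_eq_abs]
    refine Real.sqrt_lt_sqrt (sq_nonneg _) ?_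
    have := norm_coe_pos hu
    have : 0 < ‖ContinuousLinearMap.adjoint B (u : H)‖ ^ 2 / ‖(u : H)‖ ^ 2 := by positivity
    linarith
  have := (abs_lt.1 h1).2
  rw [p₁]
  linarith

/-- Multiplying by c - x clears the denominator and leaves a quadratic polynomial in x whose roots
are p₁(u) and p₂(u). -/
theorem form_schurMap_mul {x : ℝ} (hx : x ≠ c) {u : A.domain} (hu : u ≠ 0) :
    form (schurMap A B c x) u * (c - x) =
      ‖(u : H)‖ ^ 2 * ((x - p₁ A B c u) * (x - p₂ A B c u)) := by
  have hpos := norm_coe_pos hu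
  have hx' : c - x ≠ 0 := sub_ne_zero.2 hx.symm
  have hsq : rootTerm A B c u ^ 2 = 1 / 4 * (rayleigh A u - c) ^ 2 +
      ‖ContinuousLinearMap.adjoint B (u : H)‖ ^ 2 / ‖(u : H)‖ ^ 2 :=
    Real.sq_sqrt (by positivity)
  have hray : form A.toFun u = rayleigh A u * ‖(u : H)‖ ^ 2 := by
    rw [rayleigh, div_mul_cancel₀ _ (by positivity)]
    rfl
  have h1 : (x - p₁ A B c u) * (x - p₂ A B c u) = (x - (rayleigh A u + c) / 2) ^ 2 -
      rootTerm A B c u ^ 2 := by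
    rw [p₁, p₂]
    ring
  rw [h1, hsq, form_schurMap, hray]
  field_simp
  ring

/-- The zero of `x ↦ (S(x) u, u)` in `I` is `p u`, if there is one. -/
structure IsRootFunctional (A : H →ₗ.[ℂ] H) (B : K →L[ℂ] H) (c : ℝ) (I : Set ℝ)
    (p : A.domain → ℝ) : Prop where
  isOpen : IsOpen I
  ordConnected : I.OrdConnected
  ne : ∀ x ∈ I, x ≠ c
  neg_iff : ∀ x ∈ I, ∀ u : A.domain, u ≠ 0 → (form (schurMap A B c x) u < 0 ↔ p u < x)
  nonpos_iff : ∀ x ∈ I, ∀ u : A.domain, u ≠ 0 → (form (schurMap A B c x) u ≤ 0 ↔ p u ≤ x)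
  exists_max : ∀ L : Submodule ℂ A.domain, FiniteDimensional ℂ L → L ≠ ⊥ → ∃ m, IsMaxOn₀ A p L m

theorem continuousOn_rayleigh (L : Submodule ℂ A.domain) [FiniteDimensional ℂ L] :
    ContinuousOn (fun u : L => rayleigh A u) {u | u ≠ 0} := by
  have hA : Continuous fun u : L => A (u : A.domain) :=
    (A.toFun ∘ₗ L.subtype).continuous_of_finiteDimensional
  have hi : Continuous fun u : L => ((u : A.domain) : H) :=
    continuous_subtype_val.comp continuous_subtype_val
  refine ContinuousOn.div ?_ (hi.norm.pow 2).continuousOn fun u hu => ?_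
  · exact (Complex.continuous_re.comp (hi.inner hA)).continuousOn
  · have : ((u : A.domain) : H) ≠ 0 := fun h => hu (Subtype.ext (Subtype.ext h))
    positivity

theorem continuousOn_rootTerm (L : Submodule ℂ A.domain) [FiniteDimensional ℂ L] :
    ContinuousOn (fun u : L => rootTerm A B c u) {u | u ≠ 0} := by
  have hi : Continuous fun u : L => ((u : A.domain) : H) :=
    continuous_subtype_val.comp continuous_subtype_val
  refine ContinuousOn.sqrt (ContinuousOn.add ?_ (ContinuousOn.div ?_ ?_ fun u hu => ?_))
  · exact continuousOn_const.mul (((continuousOn_rayleigh L).sub continuousOn_const).pow 2)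
  · exact (((ContinuousLinearMap.adjoint B).continuous.comp hi).norm.pow 2).continuousOn
  · exact (hi.norm.pow 2).continuousOn
  · have : ((u : A.domain) : H) ≠ 0 := fun h => hu (Subtype.ext (Subtype.ext h))
    positivity

theorem rayleigh_smul {r : ℂ} (hr : r ≠ 0) (u : A.domain) :
    rayleigh A (r • u) = rayleigh A u := by
  have h1 : inner ℂ (r • (u : H)) (r • A u) = ((‖r‖ ^ 2 : ℝ) : ℂ) * inner ℂ (u : H) (A u) := by
    rw [inner_smul_left, inner_smul_right, ← mul_assoc, ← Complex.normSq_eq_conj_mul_self,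
      Complex.normSq_eq_norm_sq]
  have hr' : ‖r‖ ^ 2 ≠ 0 := by positivity
  rw [rayleigh, rayleigh, LinearPMap.map_smul, Submodule.coe_smul, h1, Complex.re_ofReal_mul,
    norm_smul, mul_pow, mul_div_mul_left _ _ hr']

theorem rootTerm_smul {r : ℂ} (hr : r ≠ 0) (u : A.domain) :
    rootTerm A B c (r • u) = rootTerm A B c u := by
  have hr' : ‖r‖ ^ 2 ≠ 0 := by positivity
  rw [rootTerm, rootTerm, rayleigh_smul hr, Submodule.coe_smul, map_smul, norm_smul, norm_smul,
    mul_pow, mul_pow, mul_div_mul_left _ _ hr']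

/-- A functional homogeneous of degree 0 takes all its values on the unit sphere, which is compact
in finite dimension. -/
theorem exists_isMaxOn₀ {p : A.domain → ℝ} {L : Submodule ℂ A.domain} [FiniteDimensional ℂ L]
    (hL : L ≠ ⊥) (hp : ContinuousOn (fun u : L => p u) {u | u ≠ 0})
    (hsmul : ∀ r : ℂ, r ≠ 0 → ∀ u, p (r • u) = p u) : ∃ m, IsMaxOn₀ A p L m := by
  have := FiniteDimensional.proper ℂ L
  have hnorm : ∀ u : L, u ≠ 0 → ((‖u‖⁻¹ : ℝ) : ℂ) • u ∈ Metric.sphere (0 : L) 1 := by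
    intro u hu
    rw [mem_sphere_zero_iff_norm, norm_smul]
    simp [hu]
  have hne : (Metric.sphere (0 : L) 1).Nonempty := by
    obtain ⟨u, hu, hu0⟩ := L.ne_bot_iff.1 hL
    exact ⟨_, hnorm ⟨u, hu⟩ fun h => hu0 (congrArg Subtype.val h)⟩
  have hsub : Metric.sphere (0 : L) 1 ⊆ {u | u ≠ 0} := fun u hu =>
    ne_zero_of_mem_unit_sphere ⟨u, hu⟩
  obtain ⟨v, hv, hmax⟩ := (isCompact_sphere (0 : L) 1).exists_isMaxOn hne (hp.mono hsub)
  refine ⟨p v, ⟨v, ⟨v.2, fun h => hsub hv (Subtype.ext h)⟩, rfl⟩, ?_⟩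
  rintro _ ⟨u, ⟨hu, hu0⟩, rfl⟩
  have hu0' : (⟨u, hu⟩ : L) ≠ 0 := fun h => hu0 (congrArg Subtype.val h)
  have h1 := hmax (hnorm ⟨u, hu⟩ hu0')
  have h2 : ((‖(⟨u, hu⟩ : L)‖⁻¹ : ℝ) : ℂ) ≠ 0 := by simpa using hu0
  change p (((‖(⟨u, hu⟩ : L)‖⁻¹ : ℝ) : ℂ) • u) ≤ p v at h1
  rwa [hsmul _ h2] at h1

theorem sign_of_eq_mul {a C q x : ℝ} (hC : 0 < C) (h : a = C * (q - x)) :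
    (a < 0 ↔ q < x) ∧ (a ≤ 0 ↔ q ≤ x) := by
  rw [h, ← smul_eq_mul, smul_neg_iff_of_pos_left hC, sub_neg, ← not_lt,
    smul_pos_iff_of_pos_left hC, sub_pos, not_lt]
  exact ⟨Iff.rfl, Iff.rfl⟩

/-- Since p₂ ≥ c > x, the form is a positive multiple of p₁(u) - x. -/
theorem sign_form_of_lt {x : ℝ} (hx : x < c) {u : A.domain} (hu : u ≠ 0) :
    (form (schurMap A B c x) u < 0 ↔ p₁ A B c u < x) ∧
      (form (schurMap A B c x) u ≤ 0 ↔ p₁ A B c u ≤ x) := by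
  have hx' : 0 < c - x := sub_pos.2 hx
  have h1 := form_schurMap_mul (B := B) hx.ne hu
  have h2 : 0 < p₂ A B c u - x := by linarith [le_p₂ (B := B) (c := c) u]
  have h3 := norm_coe_pos hu
  refine sign_of_eq_mul (C := ‖(u : H)‖ ^ 2 * (p₂ A B c u - x) / (c - x)) (by positivity) ?_
  rw [div_mul_eq_mul_div, eq_div_iff hx'.ne', h1]
  ring

/-- Now p₁ ≤ c < x, and both signs flip: the form is a positive multiple of p₂(u) - x. -/
theorem sign_form_of_gt {x : ℝ} (hx : c < x) {u : A.domain} (hu : u ≠ 0) :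
    (form (schurMap A B c x) u < 0 ↔ p₂ A B c u < x) ∧
      (form (schurMap A B c x) u ≤ 0 ↔ p₂ A B c u ≤ x) := by
  have hx' : 0 < x - c := sub_pos.2 hx
  have h1 := form_schurMap_mul (B := B) hx.ne' hu
  have h2 : 0 < x - p₁ A B c u := by linarith [p₁_le (B := B) (c := c) u]
  have h3 := norm_coe_pos hu
  refine sign_of_eq_mul (C := ‖(u : H)‖ ^ 2 * (x - p₁ A B c u) / (x - c)) (by positivity) ?_
  rw [div_mul_eq_mul_div, eq_div_iff hx'.ne']
  linear_combination -h1

theorem isRootFunctional_p₁ : IsRootFunctional A B c (Iio c) (p₁ A B c) where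
  isOpen := isOpen_Iio
  ordConnected := ordConnected_Iio
  ne _ hx := ne_of_lt hx
  neg_iff _ hx _ hu := (sign_form_of_lt hx hu).1
  nonpos_iff _ hx _ hu := (sign_form_of_lt hx hu).2
  exists_max L _ hL := exists_isMaxOn₀ hL
    ((continuousOn_const.mul ((continuousOn_rayleigh L).add continuousOn_const)).sub
      (continuousOn_rootTerm L))
    fun r hr u => by rw [p₁, p₁, rayleigh_smul hr, rootTerm_smul hr]

theorem isRootFunctional_p₂ : IsRootFunctional A B c (Ioi c) (p₂ A B c) where
  isOpen := isOpen_Ioi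
  ordConnected := ordConnected_Ioi
  ne _ hx := ne_of_gt hx
  neg_iff _ hx _ hu := (sign_form_of_gt hx hu).1
  nonpos_iff _ hx _ hu := (sign_form_of_gt hx hu).2
  exists_max L _ hL := exists_isMaxOn₀ hL
    ((continuousOn_const.mul ((continuousOn_rayleigh L).add continuousOn_const)).add
      (continuousOn_rootTerm L))
    fun r hr u => by rw [p₂, p₂, rayleigh_smul hr, rootTerm_smul hr]

end

/-! ### The variational principle -/

section

variable [CompleteSpace H] [CompleteSpace K]

theorem exists_submodule_le_rank_eq {V : Type*} [AddCommGroup V] [Module ℂ V]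
    (L : Submodule ℂ V) {m : ℕ} (hm : (m : Cardinal) ≤ Module.rank ℂ L) :
    ∃ L' ≤ L, Module.rank ℂ L' = m := by
  obtain ⟨v, hv⟩ := exists_linearIndependent_of_le_rank hm
  have hv' : LinearIndependent ℂ (fun i => (v i : V)) := hv.map' L.subtype L.ker_subtype
  refine ⟨Submodule.span ℂ (range fun i => (v i : V)), ?_, ?_⟩
  · rw [Submodule.span_le]
    rintro _ ⟨i, rfl⟩
    exact (v i).2
  · have : FiniteDimensional ℂ (Submodule.span ℂ (range fun i => (v i : V))) :=
      FiniteDimensional.span_of_finite ℂ (finite_range _)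
    rw [← Module.finrank_eq_rank, finrank_span_eq_card hv', Fintype.card_fin]

theorem finiteDimensional_of_rank_eq {V : Type*} [AddCommGroup V] [Module ℂ V]
    {n : ℕ} (hV : Module.rank ℂ V = n) : FiniteDimensional ℂ V :=
  Module.rank_lt_aleph0_iff.1 (hV ▸ Cardinal.natCast_lt_aleph0)

theorem ne_bot_of_rank_eq {V : Type*} [AddCommGroup V] [Module ℂ V] {L : Submodule ℂ V}
    {n : ℕ} (hL : Module.rank ℂ L = n) (hn : n ≠ 0) : L ≠ ⊥ := by
  rintro rfl
  rw [rank_bot] at hL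
  exact hn (by exact_mod_cast hL.symm)

variable {A : H →ₗ.[ℂ] H} {B : K →L[ℂ] H} {c : ℝ} {I : Set ℝ} {p : A.domain → ℝ}
  {N k : ℝ → ℕ} {κ : ℕ}

/-- If `y` is close to `x`, then so are the forms of `S(x)` and `S(y)`. -/
theorem eventually_form_schurMap_sub_le {x : ℝ} (hx : x ≠ c) {δ : ℝ} (hδ : 0 < δ) :
    ∀ᶠ y : ℝ in 𝓝 x, ∀ u : A.domain,
      form (schurMap A B c x) u - form (schurMap A B c y) u ≤ δ * ‖(u : H)‖ ^ 2 := by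
  have hx' : c - x ≠ 0 := sub_ne_zero.2 hx.symm
  have hcont : ContinuousAt (fun y : ℝ => |y - x| +
      |(c - y)⁻¹ - (c - x)⁻¹| * ‖ContinuousLinearMap.adjoint B‖ ^ 2) x := by
    have h1 : ContinuousAt (fun y : ℝ => (c - y)⁻¹) x :=
      (continuousAt_const.sub continuousAt_id).inv₀ hx'
    exact (continuousAt_id.sub continuousAt_const).abs.add
      ((h1.sub continuousAt_const).abs.mul continuousAt_const)
  have hev := hcont.eventually_lt_const (u := δ) (by simpa using hδ)
  filter_upwards [hev] with y hy u
  have hB : ‖ContinuousLinearMap.adjoint B (u : H)‖ ^ 2 ≤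
      ‖ContinuousLinearMap.adjoint B‖ ^ 2 * ‖(u : H)‖ ^ 2 := by
    rw [← mul_pow]
    gcongr
    exact ContinuousLinearMap.le_opNorm _ _
  rw [form_schurMap, form_schurMap]
  calc _ = (y - x) * ‖(u : H)‖ ^ 2 +
        ((c - y)⁻¹ - (c - x)⁻¹) * ‖ContinuousLinearMap.adjoint B (u : H)‖ ^ 2 := by ring
    _ ≤ |y - x| * ‖(u : H)‖ ^ 2 + |(c - y)⁻¹ - (c - x)⁻¹| *
        (‖ContinuousLinearMap.adjoint B‖ ^ 2 * ‖(u : H)‖ ^ 2) := by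
      gcongr
      · exact le_abs_self _
      · exact le_abs_self _
    _ = (|y - x| + |(c - y)⁻¹ - (c - x)⁻¹| * ‖ContinuousLinearMap.adjoint B‖ ^ 2) *
        ‖(u : H)‖ ^ 2 := by ring
    _ ≤ δ * ‖(u : H)‖ ^ 2 := by gcongr

namespace IsRootFunctional

theorem exists_neg (hp : IsRootFunctional A B c I p)
    (hN : ∀ x ∈ I, IsCount (schurMap A B c x) 0 (N x) (k x)) {x : ℝ} (hx : x ∈ I) :
    ∃ L : Submodule ℂ A.domain, Module.rank ℂ L = N x ∧ ∀ u ∈ L, u ≠ 0 → p u < x := by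
  obtain ⟨L, hL, hneg⟩ := (hN x hx).exists_lt
  refine ⟨L, hL, fun u hu hu0 => (hp.neg_iff x hx u hu0).1 ?_⟩
  simpa using hneg u hu hu0

theorem exists_nonpos (hp : IsRootFunctional A B c I p)
    (hN : ∀ x ∈ I, IsCount (schurMap A B c x) 0 (N x) (k x)) {x : ℝ} (hx : x ∈ I) :
    ∃ L : Submodule ℂ A.domain, Module.rank ℂ L = (N x + k x : ℕ) ∧
      ∀ u ∈ L, u ≠ 0 → p u ≤ x := by
  obtain ⟨L, hL, hneg⟩ := (hN x hx).exists_le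
  refine ⟨L, hL, fun u hu hu0 => (hp.nonpos_iff x hx u hu0).1 ?_⟩
  simpa using hneg u hu

theorem exists_le (hp : IsRootFunctional A B c I p)
    (hN : ∀ x ∈ I, IsCount (schurMap A B c x) 0 (N x) (k x)) {x : ℝ} (hx : x ∈ I)
    {L : Submodule ℂ A.domain} (hL : (N x : Cardinal) < Module.rank ℂ L) :
    ∃ u ∈ L, u ≠ 0 ∧ x ≤ p u := by
  obtain ⟨u, hu, hu0, h⟩ := (hN x hx).le_of_lt_rank L hL
  refine ⟨u, hu, hu0, not_lt.1 fun hlt => ?_⟩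
  have := (hp.neg_iff x hx u hu0).2 hlt
  linarith

/-- A subspace on which `p < x` has at most dimension `N x`. -/
theorem le_of_forall_lt (hp : IsRootFunctional A B c I p)
    (hN : ∀ x ∈ I, IsCount (schurMap A B c x) 0 (N x) (k x)) {x : ℝ} (hx : x ∈ I)
    {L : Submodule ℂ A.domain} {m : ℕ} (hL : Module.rank ℂ L = m)
    (hlt : ∀ u ∈ L, u ≠ 0 → p u < x) : m ≤ N x := by
  by_contra! h
  obtain ⟨u, hu, hu0, hle⟩ := hp.exists_le hN hx (L := L) (by rw [hL]; exact_mod_cast h)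
  exact absurd (hlt u hu hu0) (not_lt.2 hle)

theorem isStepFunction (hp : IsRootFunctional A B c I p)
    (hN : ∀ x ∈ I, IsCount (schurMap A B c x) 0 (N x) (k x)) (hmin : ∀ x ∈ I, κ ≤ N x)
    (hatt : ∃ x ∈ I, N x = κ) : IsStepFunction I N k κ where
  ordConnected := hp.ordConnected
  min := hmin
  attained := hatt
  -- A subspace with p ≤ x has p < y.
  add_le x hx y hy hxy := by
    obtain ⟨L, hL, hle⟩ := hp.exists_nonpos hN hx
    exact hp.le_of_forall_lt hN hy hL fun u hu hu0 => (hle u hu hu0).trans_lt hxy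
  -- On more than N(x) + k(x) dimensions the form of S(x) reaches δ‖u‖². For y close to x the form
  -- changes by at most δ‖u‖², so it cannot be negative on a subspace that large.
  right x hx := by
    obtain ⟨δ, hδ, hgap⟩ := (hN x hx).gap_of_lt_rank
    have h1 := (eventually_form_schurMap_sub_le (A := A) (B := B) (hp.ne x hx) hδ).and
      (hp.isOpen.eventually_mem hx)
    obtain ⟨y, ⟨hy, hyI⟩, hxy⟩ := ((h1.filter_mono nhdsWithin_le_nhds).and
      (self_mem_nhdsWithin (a := x) (s := Ioi x))).exists
    refine ⟨y, hyI, hxy, ?_⟩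
    by_contra! hlt
    obtain ⟨L, hL, hneg⟩ := (hN y hyI).exists_lt
    obtain ⟨u, hu, hu0, hge⟩ := hgap L (by rw [hL]; exact_mod_cast hlt)
    have h2 := hneg u hu hu0
    have h3 := hy u
    linarith
  -- The maximum of p over a finite-dimensional subspace with p < x is attained, so it stays below
  -- some y < x.
  left x hx := by
    obtain ⟨L, hL, hneg⟩ := hp.exists_neg hN hx
    have hev : ∀ m < x, ∃ y ∈ I, y < x ∧ m < y := by
      intro m hm
      obtain ⟨y, ⟨h1, h2⟩, h3⟩ := ((((hp.isOpen.eventually_mem hx).and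
        (lt_mem_nhds hm)).filter_mono nhdsWithin_le_nhds).and
        (self_mem_nhdsWithin (a := x) (s := Iio x))).exists
      exact ⟨y, h1, h3, h2⟩
    rcases eq_or_ne (N x) 0 with h0 | h0
    · obtain ⟨y, hy, hyx, -⟩ := hev (x - 1) (by linarith)
      exact ⟨y, hy, hyx, by omega⟩
    · obtain ⟨m, ⟨v, ⟨hv, hv0⟩, hvm⟩, hm⟩ :=
        hp.exists_max L (finiteDimensional_of_rank_eq hL) (ne_bot_of_rank_eq hL h0)
      obtain ⟨y, hy, hyx, hmy⟩ := hev m (hvm ▸ hneg v hv hv0)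
      exact ⟨y, hy, hyx, hp.le_of_forall_lt hN hy hL fun u hu hu0 =>
        (hm ⟨u, ⟨hu, hu0⟩, rfl⟩).trans_lt hmy⟩

/-- As m > N(x), every m-dimensional subspace contains a vector with p ≥ x. As m ≤ N(x) + k(x), some
such subspace has p ≤ x throughout, so its maximum is exactly x. -/
theorem isMinMax (hp : IsRootFunctional A B c I p)
    (hN : ∀ x ∈ I, IsCount (schurMap A B c x) 0 (N x) (k x)) {x : ℝ} (hx : x ∈ I) {m : ℕ}
    (h1 : N x < m) (h2 : m ≤ N x + k x) : IsMinMax A p m x := by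
  have hmax : ∀ L : Submodule ℂ A.domain, Module.rank ℂ L = m → ∃ y, IsMaxOn₀ A p L y :=
    fun L hL => hp.exists_max L (finiteDimensional_of_rank_eq hL)
      (ne_bot_of_rank_eq hL (by omega))
  have hlow : ∀ (L : Submodule ℂ A.domain) (y : ℝ), Module.rank ℂ L = m → IsMaxOn₀ A p L y →
      x ≤ y := by
    intro L y hL hy
    obtain ⟨u, hu, hu0, hle⟩ := hp.exists_le hN hx (L := L) (by rw [hL]; exact_mod_cast h1)
    exact hle.trans (hy.2 ⟨u, ⟨hu, hu0⟩, rfl⟩)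
  refine ⟨hmax, ?_, fun y ⟨L, hL, hy⟩ => hlow L y hL hy⟩
  obtain ⟨L₀, hL₀, hle⟩ := hp.exists_nonpos hN hx
  obtain ⟨L, hLL, hL⟩ := exists_submodule_le_rank_eq L₀ (m := m)
    (by rw [hL₀]; exact_mod_cast h2)
  obtain ⟨y, hy⟩ := hmax L hL
  have hyx : y ≤ x := by
    obtain ⟨⟨u, ⟨hu, hu0⟩, rfl⟩, -⟩ := hy
    exact hle u (hLL hu) hu0
  exact ⟨L, hL, (hyx.antisymm (hlow L y hL hy)) ▸ hy⟩

theorem isEigenvalueSequence {n : ℕ∞} {lam : ℕ → ℝ}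
    (hN : ∀ x ∈ I, IsCount (schurMap A B c x) 0 (N x) (k x)) (h : IsStepFunction I N k κ)
    (hl : IsJumpSequence I N k κ n lam) : IsEigenvalueSequence A B c I n lam where
  mem := hl.mem
  mono _ _ := hl.mono h
  mult x hx := by
    rw [hl.encard_eq h hx, schur_eq, ← (hN x hx).edim_eigenspace, Complex.ofReal_zero]

end IsRootFunctional

end

/-! ### Spectral properties of `S` -/

section

variable [CompleteSpace H] [CompleteSpace K]

variable {A : H →ₗ.[ℂ] H} {B : K →L[ℂ] H} {c : ℝ}

theorem inner_map_eq_of_isSelfAdjoint (hA : IsSelfAdjoint A) (u v : A.domain) :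
    inner ℂ (A u) (v : H) = inner ℂ (u : H) (A v) := by
  have h := A.adjoint_isFormalAdjoint hA.dense_domain
  rw [LinearPMap.isSelfAdjoint_def.1 hA] at h
  exact h u v

/-- Write A - G = (A - z) - (G - z), where z is the point at which the resolvent is known to be
compact. -/
theorem exists_compact_inverse_of_injective (hAcpt : HasCompactResolvent A) (G : H →L[ℂ] H)
    (hinj : ∀ u : A.domain, A u - G u = 0 → u = 0) :
    ∃ R : H →L[ℂ] H, IsBoundedInverse ⟨A.domain, A.toFun - G.toLinearMap ∘ₗ A.domain.subtype⟩ R ∧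
      IsCompactOperator R := by
  obtain ⟨z, R, hR, hc⟩ := hAcpt
  have heq : A.toFun - z • A.domain.subtype -
      (G - z • ContinuousLinearMap.id ℂ H).toLinearMap ∘ₗ A.domain.subtype =
        A.toFun - G.toLinearMap ∘ₗ A.domain.subtype := by
    ext u
    simp
  have h := exists_compact_inverse_sub (f := A.toFun - z • A.domain.subtype) hR hc
    (G - z • ContinuousLinearMap.id ℂ H) fun u hu => hinj u ?_
  · rwa [heq] at h
  · have := LinearMap.congr_fun heq u
    change _ = A u - G u at this
    rw [← this]
    exact hu

theorem exists_isEigenbasis_sub (hA : IsSelfAdjoint A) (hAcpt : HasCompactResolvent A)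
    (hAbdd : BoundedBelow A) {G : H →L[ℂ] H} (hG : G.toLinearMap.IsSymmetric) :
    ∃ (ι : Type) (b : HilbertBasis ι ℂ H) (x : ι → ℝ),
      IsEigenbasis (A.toFun - G.toLinearMap ∘ₗ A.domain.subtype) b x := by
  obtain ⟨m, hm⟩ := hAbdd
  -- A - G is bounded below by m - ‖G‖; the extra 1 makes the bound strict, which gives injectivity
  -- at this point.
  have hz : ∀ u : A.domain, u ≠ 0 → (m - ‖G‖ - 1) * ‖(u : H)‖ ^ 2 <
      form (A.toFun - G.toLinearMap ∘ₗ A.domain.subtype) u := by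
    intro u hu
    have h1 := hm u
    have h2 : (inner ℂ (u : H) (G u)).re ≤ ‖G‖ * ‖(u : H)‖ ^ 2 := by
      refine (Complex.re_le_norm _).trans ((norm_inner_le_norm _ _).trans ?_)
      calc ‖(u : H)‖ * ‖G u‖ ≤ ‖(u : H)‖ * (‖G‖ * ‖(u : H)‖) := by
            gcongr
            exact G.le_opNorm _
        _ = ‖G‖ * ‖(u : H)‖ ^ 2 := by ring
    have h3 : 0 < ‖(u : H)‖ ^ 2 := pow_pos (norm_coe_pos hu) 2
    change _ < (inner ℂ (u : H) (A u - G u)).re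
    rw [inner_sub_right, Complex.sub_re]
    linarith
  obtain ⟨R, hR, hc⟩ := exists_compact_inverse_of_injective hAcpt
    (G + ((m - ‖G‖ - 1 : ℝ) : ℂ) • ContinuousLinearMap.id ℂ H) fun u hu => by
      by_contra hu0
      have h1 := hz u hu0
      have h2 : (A.toFun - G.toLinearMap ∘ₗ A.domain.subtype) u =
          ((m - ‖G‖ - 1 : ℝ) : ℂ) • (u : H) := by
        rw [← sub_eq_zero, ← hu]
        change A u - G u - _ = A u - (G u + _)
        rw [sub_sub]
        rfl
      rw [form, h2, inner_smul_right, inner_self_eq_norm_sq_to_K, Complex.re_ofReal_mul] at h1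
      norm_cast at h1
      exact lt_irrefl _ h1
  refine exists_isEigenbasis (fun u v => ?_) hz (R := R) ?_ hc
  · change inner ℂ (A u - G u) (v : H) = inner ℂ (u : H) (A v - G v)
    rw [inner_sub_left, inner_sub_right, inner_map_eq_of_isSelfAdjoint hA]
    congr 1
    exact hG u v
  · convert hR using 2
    ext u
    simp [sub_sub]

theorem exists_isEigenbasis_toFun (hA : IsSelfAdjoint A) (hAcpt : HasCompactResolvent A)
    (hAbdd : BoundedBelow A) :
    ∃ (ι : Type) (b : HilbertBasis ι ℂ H) (x : ι → ℝ), IsEigenbasis A.toFun b x := by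
  have h := exists_isEigenbasis_sub hA hAcpt hAbdd (G := 0) (fun u v => by simp)
  rwa [show A.toFun - (0 : H →L[ℂ] H).toLinearMap ∘ₗ A.domain.subtype = A.toFun by
    ext u; simp] at h

/-- The bounded operator `z + (c - z)⁻¹ B B*`. -/
def schurShift (B : K →L[ℂ] H) (c : ℝ) (z : ℂ) : H →L[ℂ] H :=
  z • ContinuousLinearMap.id ℂ H + ((c : ℂ) - z)⁻¹ • (B ∘L ContinuousLinearMap.adjoint B)

theorem schurMap_eq (A : H →ₗ.[ℂ] H) (B : K →L[ℂ] H) (c : ℝ) (z : ℂ) :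
    schurMap A B c z = A.toFun - (schurShift B c z).toLinearMap ∘ₗ A.domain.subtype := by
  ext u
  simp [schurMap, schurShift, sub_sub]

/-- For real x the bounded part of S(x) is symmetric. The point x = c need not be excluded, since
there (c - x)⁻¹ is 0 by convention. -/
theorem exists_isCount_schurMap (hA : IsSelfAdjoint A) (hAcpt : HasCompactResolvent A)
    (hAbdd : BoundedBelow A) (B : K →L[ℂ] H) (c x : ℝ) :
    ∃ N k : ℕ, IsCount (schurMap A B c x) 0 N k := by
  obtain ⟨ι, b, e, h⟩ := exists_isEigenbasis_sub hA hAcpt hAbdd (G := schurShift B c x) <| by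
    intro u v
    have h1 : ∀ w : H, (schurShift B c x).toLinearMap w =
        (x : ℂ) • w + ((c - x : ℝ)⁻¹ : ℂ) • B (ContinuousLinearMap.adjoint B w) := by
      intro w
      simp [schurShift]
    have h2 : inner ℂ (B (ContinuousLinearMap.adjoint B u)) v =
        inner ℂ u (B (ContinuousLinearMap.adjoint B v)) := by
      rw [← ContinuousLinearMap.adjoint_inner_right, ← ContinuousLinearMap.adjoint_inner_left B]
    rw [h1, h1, inner_add_left, inner_add_right, inner_smul_left, inner_smul_left,
      inner_smul_right, inner_smul_right, h2, ← Complex.ofReal_inv, Complex.conj_ofReal,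
      Complex.conj_ofReal]
  rw [schurMap_eq]
  exact h.exists_isCount 0

theorem shift_zero (T : H →ₗ.[ℂ] H) : shift T 0 = T := by
  rw [shift, zero_smul, sub_zero]

theorem eigenspace_schur_zero_eq_bot_iff (z : ℂ) :
    eigenspace (schur A B c z) 0 = ⊥ ↔ ∀ u : A.domain, schurMap A B c z u = 0 → u = 0 := by
  rw [eigenspace, (Submodule.map_injective_of_injective (Submodule.subtype_injective _)).eq_iff'
    (Submodule.map_bot _), zero_smul, sub_zero, LinearMap.ker_eq_bot']
  rfl

theorem zero_mem_resolventSet_schur_iff (hAcpt : HasCompactResolvent A) (z : ℂ) :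
    0 ∈ resolventSet (schur A B c z) ↔ eigenspace (schur A B c z) 0 = ⊥ := by
  change (∃ R : H →L[ℂ] H, IsBoundedInverse (shift (schur A B c z) 0) R) ↔ _
  rw [shift_zero, eigenspace_schur_zero_eq_bot_iff]
  constructor
  · rintro ⟨R, hR⟩ u hu
    have h : R (schurMap A B c z u) = u := hR.2 u
    rw [hu, map_zero] at h
    exact Subtype.ext h.symm
  · intro h
    obtain ⟨R, hR, -⟩ := exists_compact_inverse_of_injective hAcpt (schurShift B c z)
      fun u hu => h u (by rw [schurMap_eq]; exact hu)
    rw [← schurMap_eq] at hR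
    exact ⟨R, hR⟩

theorem schurSpec_eq_schurPointSpec (hAcpt : HasCompactResolvent A) :
    schurSpec A B c = schurPointSpec A B c := by
  ext z
  refine and_congr_right fun _ => ?_
  exact not_congr (zero_mem_resolventSet_schur_iff hAcpt z)

/-- The imaginary part of (S(z)u, u) is -Im z (‖u‖² + ‖B*u‖² / |c - z|²), which vanishes only for u
= 0. -/
theorem eigenspace_schur_zero_of_im_ne_zero (hA : IsSelfAdjoint A) {z : ℂ} (hz : z.im ≠ 0) :
    eigenspace (schur A B c z) 0 = ⊥ := by
  rw [eigenspace_schur_zero_eq_bot_iff]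
  intro u hu
  have h1 := inner_schurMap (A := A) (B := B) (c := c) z u
  have h2 : (inner ℂ (u : H) (A u)).im = 0 := by
    have h := inner_map_eq_of_isSelfAdjoint hA u u
    rw [← inner_conj_symm] at h
    exact Complex.conj_eq_iff_im.1 h
  have h3 := congrArg Complex.im h1
  rw [hu, inner_zero_right, Complex.sub_im, Complex.sub_im, Complex.im_mul_ofReal,
    Complex.im_mul_ofReal, h2, Complex.inv_im, Complex.sub_im, Complex.ofReal_im] at h3
  have h4 : z.im * (‖(u : H)‖ ^ 2 + (Complex.normSq ((c : ℂ) - z))⁻¹ *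
      ‖ContinuousLinearMap.adjoint B (u : H)‖ ^ 2) = 0 := by
    simp only [Complex.zero_im] at h3
    linear_combination h3
  have h5 := (mul_eq_zero.1 h4).resolve_left hz
  have h6 : 0 ≤ (Complex.normSq ((c : ℂ) - z))⁻¹ *
      ‖ContinuousLinearMap.adjoint B (u : H)‖ ^ 2 :=
    mul_nonneg (inv_nonneg.2 (Complex.normSq_nonneg _)) (sq_nonneg _)
  have h7 : ‖(u : H)‖ ^ 2 = 0 := le_antisymm (by linarith) (sq_nonneg _)
  exact Subtype.ext (by simpa using h7)

/-- `A - β` is bounded below by the norm, up to a multiple of the spectral projection. -/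
theorem exists_le_form_add_starProjection (hA : IsSelfAdjoint A)
    (hAcpt : HasCompactResolvent A) (hAbdd : BoundedBelow A) (c : ℝ) :
    ∃ β > c, ∃ M ≥ (0 : ℝ), ∀ u : A.domain, β * ‖(u : H)‖ ^ 2 ≤ form A.toFun u +
      M * ‖(spectralSubspace A (Iic c)).starProjection (u : H)‖ ^ 2 := by
  obtain ⟨ι, b, x, h⟩ := exists_isEigenbasis_toFun hA hAcpt hAbdd
  obtain ⟨m, hm⟩ := hAbdd
  have hmx : ∀ i, m ≤ x i := by
    intro i
    have h1 : m * ‖b i‖ ^ 2 ≤ form A.toFun ⟨b i, h.mem i⟩ := hm ⟨b i, h.mem i⟩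
    rw [form, h.apply, inner_smul_right, inner_self_eq_norm_sq_to_K, b.orthonormal.1] at h1
    simpa using h1
  obtain ⟨δ, hδ, hgap⟩ := h.exists_gap c
  -- β = c + δ uses the gap above c. Coefficientwise, an eigenvalue in [m, c] falls short of β by at
  -- most c + δ - m, and the projection fixes its eigenvector.
  refine ⟨c + δ, by linarith, max (c + δ - m) 0, le_max_right _ _, fun u => ?_⟩
  have hspec := h.spectralSubspace_eq (I := Iic c) (M := c) fun t ht => ht
  change spectralSubspace A (Iic c) = _ at hspec
  refine hasSum_le (fun i => ?_) ((hasSum_norm_inner_sq b (u : H)).mul_left _)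
    ((h.hasSum_form u).add ((hasSum_norm_inner_sq b _).mul_left _))
  rcases hgap i with hi | hi
  · have hbi : b i ∈ spectralSubspace A (Iic c) := by
      rw [hspec]
      exact Submodule.subset_span ⟨i, hi, rfl⟩
    rw [← Submodule.inner_starProjection_left_eq_right,
      Submodule.starProjection_eq_self_iff.2 hbi, ← add_mul]
    refine mul_le_mul_of_nonneg_right ?_ (sq_nonneg _)
    linarith [hmx i, le_max_left (c + δ - m) 0]
  · have : 0 ≤ max (c + δ - m) 0 * ‖inner ℂ (b i)
        ((spectralSubspace A (Iic c)).starProjection (u : H))‖ ^ 2 :=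
      mul_nonneg (le_max_right _ _) (sq_nonneg _)
    have h2 : (c + δ) * ‖inner ℂ (b i) (u : H)‖ ^ 2 ≤ x i * ‖inner ℂ (b i) (u : H)‖ ^ 2 := by
      gcongr
    linarith

end

/-! ### Estimates for the number of negative eigenvalues -/

section

variable [CompleteSpace H] [CompleteSpace K]

variable {A : H →ₗ.[ℂ] H} {B : K →L[ℂ] H} {c : ℝ}

theorem edim_eq_top_iff (V : Submodule ℂ H) : edim V = ⊤ ↔ ¬ FiniteDimensional ℂ V := by
  rw [edim, Cardinal.toENat_eq_top, ← not_lt, Module.rank_lt_aleph0_iff]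

theorem edim_le_of_rank_le {V W : Submodule ℂ H} (h : Module.rank ℂ V ≤ Module.rank ℂ W) :
    edim V ≤ edim W :=
  OrderHomClass.mono Cardinal.toENat h

theorem natCast_le_rank {V : Type*} [AddCommGroup V] [Module ℂ V]
    (h : ¬ FiniteDimensional ℂ V) (m : ℕ) : (m : Cardinal) ≤ Module.rank ℂ V :=
  Cardinal.natCast_le_aleph0.trans (not_lt.1 fun hlt => h (Module.rank_lt_aleph0_iff.1 hlt))

theorem finiteDimensional_of_dense {V : Submodule ℂ H} (hV : Dense (V : Set H))
    [FiniteDimensional ℂ V] : FiniteDimensional ℂ H := by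
  have h : V = ⊤ := by
    rw [← V.closed_of_finiteDimensional.submodule_topologicalClosure_eq]
    exact Submodule.dense_iff_topologicalClosure_eq_top.1 hV
  have : FiniteDimensional ℂ (⊤ : Submodule ℂ H) := h ▸ inferInstance
  exact Module.finite_def.2 (Module.Finite.iff_fg.1 this)

/-- If `B` has infinite rank, then `B*` is injective on subspaces of `D` of any dimension. -/
theorem exists_submodule_adjoint_injOn {D : Submodule ℂ H} (hD : Dense (D : Set H))
    (hB : ¬ FiniteDimensional ℂ (LinearMap.range B.toLinearMap).topologicalClosure) (m : ℕ) :
    ∃ L : Submodule ℂ D, Module.rank ℂ L = m ∧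
      ∀ u ∈ L, ContinuousLinearMap.adjoint B (u : H) = 0 → u = 0 := by
  let g : D →ₗ[ℂ] K := (ContinuousLinearMap.adjoint B).toLinearMap ∘ₗ D.subtype
  -- If B*(D) were finite-dimensional it would be closed, hence by density contain ran B*. Then B
  -- would vanish on its orthogonal complement and have finite rank.
  have hg : ¬ FiniteDimensional ℂ (LinearMap.range g) := by
    intro hfin
    have hcl : IsClosed ((LinearMap.range g : Submodule ℂ K) : Set K) :=
      Submodule.closed_of_finiteDimensional _
    have hmem : ∀ u : H, ContinuousLinearMap.adjoint B u ∈ LinearMap.range g := by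
      have hsub : {u : H | ContinuousLinearMap.adjoint B u ∈ LinearMap.range g} = univ :=
        (hcl.preimage (ContinuousLinearMap.adjoint B).continuous).closure_eq.symm.trans
          ((hD.mono fun u hu => (⟨⟨u, hu⟩, rfl⟩ :
            ContinuousLinearMap.adjoint B u ∈ LinearMap.range g)).closure_eq)
      exact eq_univ_iff_forall.1 hsub
    have hker : ∀ w ∈ (LinearMap.range g)ᗮ, B w = 0 := by
      intro w hw
      have h1 := hw _ (hmem (B w))
      rw [ContinuousLinearMap.adjoint_inner_left] at h1
      exact inner_self_eq_zero.1 h1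
    have hle : LinearMap.range B.toLinearMap ≤ (LinearMap.range g).map B.toLinearMap := by
      rintro _ ⟨w, rfl⟩
      refine ⟨(LinearMap.range g).starProjection w, Submodule.starProjection_apply_mem _ w, ?_⟩
      have h2 := hker _ (Submodule.sub_starProjection_mem_orthogonal (K := LinearMap.range g) w)
      rw [map_sub, sub_eq_zero] at h2
      exact h2.symm
    have hfin2 : FiniteDimensional ℂ (LinearMap.range B.toLinearMap) :=
      Submodule.finiteDimensional_of_le hle
    have heq : (LinearMap.range B.toLinearMap).topologicalClosure =
        LinearMap.range B.toLinearMap :=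
      (Submodule.closed_of_finiteDimensional _).submodule_topologicalClosure_eq
    rw [heq] at hB
    exact hB hfin2
  obtain ⟨Q, hQ⟩ := (LinearMap.ker g).exists_isCompl
  let e : Q ≃ₗ[ℂ] LinearMap.range g :=
    (Submodule.quotientEquivOfIsCompl _ Q hQ).symm.trans g.quotKerEquivRange
  have hQfin : ¬ FiniteDimensional ℂ Q := fun h => hg e.finiteDimensional
  obtain ⟨L, hLQ, hL⟩ := exists_submodule_le_rank_eq Q (natCast_le_rank hQfin m)
  refine ⟨L, hL, fun u hu hu0 => ?_⟩
  have h3 : u ∈ LinearMap.ker g ⊓ Q := ⟨LinearMap.mem_ker.2 hu0, hLQ hu⟩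
  rwa [hQ.inf_eq_bot, Submodule.mem_bot] at h3

/-- Let y be the component of u in (ker B*)ᗮ = ran B. The open mapping theorem gives y = Bw with ‖w‖
≤ C‖y‖, so ‖y‖² = (B*y, w) ≤ C‖B*u‖‖y‖. -/
theorem exists_norm_sub_starProjection_le (hB : IsClosed (range B)) :
    ∃ C > 0, ∀ u : H, ‖u - (LinearMap.ker
      (ContinuousLinearMap.adjoint B).toLinearMap).starProjection u‖ ≤
        C * ‖ContinuousLinearMap.adjoint B u‖ := by
  set W := LinearMap.ker (ContinuousLinearMap.adjoint B).toLinearMap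
  have hcl : IsClosed ((LinearMap.range B.toLinearMap : Submodule ℂ H) : Set H) := hB
  have : CompleteSpace (LinearMap.range B.toLinearMap) := hcl.completeSpace_coe
  let B' : K →L[ℂ] LinearMap.range B.toLinearMap :=
    B.codRestrict _ fun w => ⟨w, rfl⟩
  obtain ⟨C, hC, h⟩ := B'.exists_preimage_norm_le (by
    rintro ⟨_, w, rfl⟩
    exact ⟨w, rfl⟩)
  refine ⟨C, hC, fun u => ?_⟩
  have hmem : u - W.starProjection u ∈ LinearMap.range B.toLinearMap := by
    have h1 : u - W.starProjection u ∈ Wᗮ := Submodule.sub_starProjection_mem_orthogonal u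
    have h2 := (ContinuousLinearMap.adjoint B).orthogonal_ker
    rw [ContinuousLinearMap.adjoint_adjoint] at h2
    have h3 : Wᗮ = LinearMap.range B.toLinearMap :=
      h2.trans hcl.submodule_topologicalClosure_eq
    rwa [h3] at h1
  obtain ⟨w, hw, hwn⟩ := h ⟨_, hmem⟩
  have hw' : B w = u - W.starProjection u := congrArg Subtype.val hw
  set y := u - W.starProjection u with hy
  have hBy : ContinuousLinearMap.adjoint B y = ContinuousLinearMap.adjoint B u := by
    have : ContinuousLinearMap.adjoint B (W.starProjection u) = 0 :=
      LinearMap.mem_ker.1 (W.starProjection_apply_mem u)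
    rw [hy, map_sub, this, sub_zero]
  have h4 : ‖y‖ ^ 2 ≤ ‖ContinuousLinearMap.adjoint B u‖ * (C * ‖y‖) := by
    have h5 : inner ℂ (ContinuousLinearMap.adjoint B y) w = ((‖y‖ ^ 2 : ℝ) : ℂ) := by
      rw [ContinuousLinearMap.adjoint_inner_left, hw', inner_self_eq_norm_sq_to_K]
      norm_cast
    have h6 := norm_inner_le_norm (𝕜 := ℂ) (ContinuousLinearMap.adjoint B y) w
    rw [h5, Complex.norm_real, Real.norm_of_nonneg (sq_nonneg _), hBy] at h6
    exact h6.trans (mul_le_mul_of_nonneg_left hwn (norm_nonneg _))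
  rcases (norm_nonneg y).eq_or_lt with h0 | h0
  · rw [← h0]
    positivity
  · refine le_of_mul_le_mul_right ?_ h0
    linarith

theorem edim_range_comp_starProjection_le (V W : Submodule ℂ H) [V.HasOrthogonalProjection]
    [W.HasOrthogonalProjection] :
    edim (LinearMap.range (V.starProjection ∘L W.starProjection).toLinearMap) ≤
      min (edim V) (edim W) := by
  refine le_min (edim_le_of_rank_le (Submodule.rank_mono ?_)) (edim_le_of_rank_le ?_)
  · rintro _ ⟨u, rfl⟩
    exact V.starProjection_apply_mem _
  · have hle : LinearMap.range (V.starProjection ∘L W.starProjection).toLinearMap ≤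
        W.map V.starProjection.toLinearMap := by
      rintro _ ⟨u, rfl⟩
      exact ⟨_, W.starProjection_apply_mem u, rfl⟩
    exact (Submodule.rank_mono hle).trans (rank_map_le _ _)

section Count

variable {N k : ℝ → ℕ} {κ : ℕ}

theorem exists_count_eq_zero (hAbdd : BoundedBelow A)
    (hN : ∀ x ∈ Iio c, IsCount (schurMap A B c x) 0 (N x) (k x)) : ∃ x ∈ Iio c, N x = 0 := by
  obtain ⟨m, hm⟩ := hAbdd
  -- x ≤ c - 1 gives (c - x)⁻¹ ≤ 1, and x ≤ m - ‖B*‖² then makes S(x) nonnegative.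
  have hx : min (c - 1) (m - ‖ContinuousLinearMap.adjoint B‖ ^ 2) ∈ Iio c :=
    lt_of_le_of_lt (b := c - 1) (min_le_left _ _) (by linarith)
  refine ⟨_, hx, ?_⟩
  set x := min (c - 1) (m - ‖ContinuousLinearMap.adjoint B‖ ^ 2)
  have hx1 : x ≤ c - 1 := min_le_left _ _
  have hx2 : x ≤ m - ‖ContinuousLinearMap.adjoint B‖ ^ 2 := min_le_right _ _
  by_contra h0
  obtain ⟨L, hL, hneg⟩ := (hN x hx).exists_lt
  obtain ⟨u, hu, hu0⟩ := L.ne_bot_iff.1 (ne_bot_of_rank_eq hL h0)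
  have h1 := hneg u hu hu0
  rw [form_schurMap] at h1
  have h2 : m * ‖(u : H)‖ ^ 2 ≤ form A.toFun u := hm u
  have h3 : (c - x)⁻¹ * ‖ContinuousLinearMap.adjoint B (u : H)‖ ^ 2 ≤
      1 * (‖ContinuousLinearMap.adjoint B‖ * ‖(u : H)‖) ^ 2 := by
    gcongr
    · exact inv_le_one_of_one_le₀ (by linarith)
    · exact ContinuousLinearMap.le_opNorm _ _
  have h4 : x * ‖(u : H)‖ ^ 2 ≤ (m - ‖ContinuousLinearMap.adjoint B‖ ^ 2) * ‖(u : H)‖ ^ 2 := by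
    gcongr
  rw [mul_pow] at h3
  linarith

/-- To the right of c the term with B only increases the form. With δ the gap of A above c, S(c + δ)
therefore has at most as many negative eigenvalues as A has eigenvalues ≤ c. -/
theorem le_of_isCount_toFun {N₀ k₀ : ℕ} (hA₀ : IsCount A.toFun c N₀ k₀)
    (hN : ∀ x ∈ Ioi c, IsCount (schurMap A B c x) 0 (N x) (k x)) (hκ : ∀ x ∈ Ioi c, κ ≤ N x) :
    κ ≤ N₀ + k₀ := by
  obtain ⟨δ, hδ, hgap⟩ := hA₀.gap_of_lt_rank
  have hx : c + δ ∈ Ioi c := by simpa using hδ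
  refine (hκ _ hx).trans ?_
  by_contra! hlt
  obtain ⟨L, hL, hneg⟩ := (hN _ hx).exists_lt
  obtain ⟨u, hu, hu0, hge⟩ := hgap L (by rw [hL]; exact_mod_cast hlt)
  have h1 := hneg u hu hu0
  rw [form_schurMap, show c - (c + δ) = -δ by ring, inv_neg] at h1
  have h2 : 0 ≤ δ⁻¹ * ‖ContinuousLinearMap.adjoint B (u : H)‖ ^ 2 := by positivity
  linarith

/-- The vectors orthogonal to ran B in a negative subspace of S(x) have codimension at most dim ran
B. There (Au, u) < c‖u‖², so they span at most N₀ + k₀ dimensions. -/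
theorem count_le_of_finiteDimensional_range {N₀ k₀ : ℕ} (hA₀ : IsCount A.toFun c N₀ k₀)
    (hN : ∀ x ∈ Iio c, IsCount (schurMap A B c x) 0 (N x) (k x))
    [FiniteDimensional ℂ (LinearMap.range B.toLinearMap).topologicalClosure] {x : ℝ}
    (hx : x ∈ Iio c) : N x ≤ N₀ + k₀ +
      Module.finrank ℂ (LinearMap.range B.toLinearMap).topologicalClosure := by
  set W := (LinearMap.range B.toLinearMap).topologicalClosure
  obtain ⟨δ, hδ, hgap⟩ := hA₀.gap_of_lt_rank
  obtain ⟨L, hL, hneg⟩ := (hN x hx).exists_lt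
  have := finiteDimensional_of_rank_eq hL
  by_contra! hlt
  let φ : L →ₗ[ℂ] W := W.orthogonalProjectionOnto.toLinearMap ∘ₗ A.domain.subtype ∘ₗ L.subtype
  have h1 := φ.finrank_range_add_finrank_ker
  have h2 : Module.finrank ℂ (LinearMap.range φ) ≤ Module.finrank ℂ W := Submodule.finrank_le _
  have h3 : Module.finrank ℂ L = N x := Module.finrank_eq_of_rank_eq hL
  have h4 : Module.finrank ℂ ((LinearMap.ker φ).map L.subtype) =
      Module.finrank ℂ (LinearMap.ker φ) :=
    (Submodule.equivMapOfInjective L.subtype L.subtype_injective _).finrank_eq.symm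
  obtain ⟨u, ⟨v, hv, rfl⟩, hu0, hge⟩ := hgap ((LinearMap.ker φ).map L.subtype) (by
    rw [← Module.finrank_eq_rank, h4]
    exact_mod_cast (by omega))
  have h5 := hneg v v.2 hu0
  have hB : ContinuousLinearMap.adjoint B ((v : A.domain) : H) = 0 := by
    have h6 : ((v : A.domain) : H) ∈ Wᗮ :=
      Submodule.orthogonalProjectionOnto_eq_zero_iff.1 (LinearMap.mem_ker.1 hv)
    have h7 := h6 (B (ContinuousLinearMap.adjoint B ((v : A.domain) : H)))
      (Submodule.le_topologicalClosure _ ⟨_, rfl⟩)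
    rw [← ContinuousLinearMap.adjoint_inner_right] at h7
    exact inner_self_eq_zero.1 h7
  rw [form_schurMap, hB, norm_zero] at h5
  have h8 : 0 < ‖((v : A.domain) : H)‖ ^ 2 := pow_pos (norm_coe_pos hu0) 2
  have h9 : x < c := hx
  change (c + δ) * ‖((v : A.domain) : H)‖ ^ 2 ≤ form A.toFun v at hge
  nlinarith

/-- For small ε, P_A P_B is injective on a negative subspace of S(c + ε). If P_A P_B u = 0, then
‖P_A u‖ = ‖P_A(u - P_B u)‖ ≤ C‖B*u‖, so the possible deficit of A is at most MC²‖B*u‖², which the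
term ε⁻¹‖B*u‖² outweighs. -/
theorem le_edim_range_of_isClosed_range (hA : IsSelfAdjoint A) (hAcpt : HasCompactResolvent A)
    (hAbdd : BoundedBelow A) (hN : ∀ x ∈ Ioi c, IsCount (schurMap A B c x) 0 (N x) (k x))
    (hκ : ∀ x ∈ Ioi c, κ ≤ N x) (hB : IsClosed (range B)) :
    (κ : ℕ∞) ≤ edim (LinearMap.range ((spectralSubspace A (Iic c)).starProjection ∘L
      (LinearMap.ker (ContinuousLinearMap.adjoint B).toLinearMap).starProjection).toLinearMap) := by
  set PA := (spectralSubspace A (Iic c)).starProjection with hPA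
  set PB := (LinearMap.ker (ContinuousLinearMap.adjoint B).toLinearMap).starProjection with hPB
  obtain ⟨β, hβ, M, hM, hform⟩ := exists_le_form_add_starProjection hA hAcpt hAbdd c
  obtain ⟨C, hC, hCB⟩ := exists_norm_sub_starProjection_le hB
  -- The first bound yields c + ε ≤ β, the second ε⁻¹ ≥ MC² + 1.
  have hε : 0 < min (β - c) (M * C ^ 2 + 1)⁻¹ := lt_min (sub_pos.2 hβ) (by positivity)
  set ε := min (β - c) (M * C ^ 2 + 1)⁻¹
  have hε1 : ε ≤ β - c := min_le_left _ _
  have hε2 : M * C ^ 2 + 1 ≤ ε⁻¹ := by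
    rw [le_inv_comm₀ (by positivity) hε]
    exact min_le_right _ _
  have hx : c + ε ∈ Ioi c := by simpa using hε
  obtain ⟨L, hL, hneg⟩ := (hN _ hx).exists_lt
  let φ : L →ₗ[ℂ] H := (PA ∘L PB).toLinearMap ∘ₗ A.domain.subtype ∘ₗ L.subtype
  have hφ : Function.Injective φ := by
    rw [← LinearMap.ker_eq_bot, Submodule.eq_bot_iff]
    intro u hu
    by_contra hu0
    have hu0' : (u : A.domain) ≠ 0 := fun h => hu0 (Subtype.ext h)
    have h1 := hneg u u.2 hu0'
    rw [form_schurMap, show c - (c + ε) = -ε by ring, inv_neg] at h1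
    have h2 : PA ((u : A.domain) : H) = PA (((u : A.domain) : H) - PB ((u : A.domain) : H)) := by
      have h3 : PA (PB ((u : A.domain) : H)) = 0 := hu
      rw [map_sub, h3, sub_zero]
    have h4 : ‖PA ((u : A.domain) : H)‖ ^ 2 ≤
        (C * ‖ContinuousLinearMap.adjoint B ((u : A.domain) : H)‖) ^ 2 := by
      rw [h2]
      gcongr
      exact (Submodule.norm_starProjection_apply_le _ _).trans (hCB _)
    have h5 := hform u
    have h6 : M * ‖PA ((u : A.domain) : H)‖ ^ 2 ≤
        M * (C * ‖ContinuousLinearMap.adjoint B ((u : A.domain) : H)‖) ^ 2 := by gcongr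
    have h7 : (M * C ^ 2 + 1) * ‖ContinuousLinearMap.adjoint B ((u : A.domain) : H)‖ ^ 2 ≤
        ε⁻¹ * ‖ContinuousLinearMap.adjoint B ((u : A.domain) : H)‖ ^ 2 := by gcongr
    have h8 : (c + ε) * ‖((u : A.domain) : H)‖ ^ 2 ≤ β * ‖((u : A.domain) : H)‖ ^ 2 := by
      gcongr
      linarith
    have h9 := sq_nonneg ‖ContinuousLinearMap.adjoint B ((u : A.domain) : H)‖
    rw [mul_pow] at h6
    linarith
  have h1 : (κ : Cardinal) ≤ Module.rank ℂ L := by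
    rw [hL]
    exact_mod_cast hκ _ hx
  have h2 : Module.rank ℂ L ≤ Module.rank ℂ (LinearMap.range (PA ∘L PB).toLinearMap) := by
    rw [← rank_range_of_injective φ hφ]
    refine Submodule.rank_mono ?_
    rintro _ ⟨u, rfl⟩
    exact ⟨_, rfl⟩
  have h3 := OrderHomClass.mono Cardinal.toENat (h1.trans h2)
  rwa [map_natCast] at h3

end Count

end

/-! ### The spectrum of `S` -/

section

variable [CompleteSpace H] [CompleteSpace K]

variable {A : H →ₗ.[ℂ] H} {B : K →L[ℂ] H} {c : ℝ} {I : Set ℝ} {p : A.domain → ℝ}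
  {N k : ℝ → ℕ} {κ : ℕ} {n : ℕ∞} {lam : ℕ → ℝ}

theorem finiteDimensional_domain_iff (hA : IsSelfAdjoint A) :
    FiniteDimensional ℂ A.domain ↔ FiniteDimensional ℂ H :=
  ⟨fun _ => finiteDimensional_of_dense hA.dense_domain, fun _ => inferInstance⟩

/-- The eigenvalues of `S` in `I` are the terms of the sequence. -/
theorem ofReal_mem_schurSpec_iff (hAcpt : HasCompactResolvent A) (hI : c ∉ I)
    (hN : ∀ x ∈ I, IsCount (schurMap A B c x) 0 (N x) (k x)) (h : IsStepFunction I N k κ)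
    (hl : IsJumpSequence I N k κ n lam) {x : ℝ} (hx : x ∈ I) :
    (x : ℂ) ∈ schurSpec A B c ↔ ∃ j : ℕ, (j : ℕ∞) < n ∧ (x : ℂ) = lam j := by
  have hne : (x : ℂ) ≠ c := fun h => hI (Complex.ofReal_injective h ▸ hx)
  have h1 : (x : ℂ) ∈ schurSpec A B c ↔ k x ≠ 0 := by
    have h2 : (x : ℂ) ∈ schurSpec A B c ↔ ¬ (eigenspace (schur A B c x) 0 = ⊥) :=
      (and_iff_right hne).trans (not_congr (zero_mem_resolventSet_schur_iff hAcpt x))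
    have h3 := (hN x hx).edim_eigenspace
    rw [← schur_eq, Complex.ofReal_zero] at h3
    rw [h2, not_iff_not]
    constructor
    · intro h0
      rw [h0, edim, rank_bot, map_zero] at h3
      exact_mod_cast h3.symm
    · intro h0
      rw [h0, edim, Nat.cast_zero, Cardinal.toENat_eq_zero] at h3
      exact Submodule.rank_eq_zero.1 h3
  rw [h1]
  constructor
  · intro hk
    have := h.min x hx
    obtain ⟨hj, hlam⟩ := (hl.eq_iff x hx (N x - κ)).2 ⟨by omega, by omega⟩
    exact ⟨_, hj, by rw [hlam]⟩
  · rintro ⟨j, hj, hxj⟩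
    have := (hl.eq_iff x hx j).1 ⟨hj, (Complex.ofReal_injective hxj).symm⟩
    omega

theorem schurSpec_eq_union (hA : IsSelfAdjoint A) (hAcpt : HasCompactResolvent A)
    {N₁ k₁ N₂ k₂ : ℝ → ℕ} {κ₁ κ₂ : ℕ} {n₁ n₂ : ℕ∞} {lam₁ lam₂ : ℕ → ℝ}
    (hN₁ : ∀ x ∈ Iio c, IsCount (schurMap A B c x) 0 (N₁ x) (k₁ x))
    (hN₂ : ∀ x ∈ Ioi c, IsCount (schurMap A B c x) 0 (N₂ x) (k₂ x))
    (h₁ : IsStepFunction (Iio c) N₁ k₁ κ₁) (h₂ : IsStepFunction (Ioi c) N₂ k₂ κ₂)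
    (hl₁ : IsJumpSequence (Iio c) N₁ k₁ κ₁ n₁ lam₁)
    (hl₂ : IsJumpSequence (Ioi c) N₂ k₂ κ₂ n₂ lam₂) :
    schurSpec A B c = {z : ℂ | ∃ j : ℕ, (j : ℕ∞) < n₁ ∧ z = (lam₁ j : ℂ)} ∪
      {z : ℂ | ∃ j : ℕ, (j : ℕ∞) < n₂ ∧ z = (lam₂ j : ℂ)} := by
  have e₁ : ∀ x ∈ Iio c, _ := fun x hx =>
    ofReal_mem_schurSpec_iff hAcpt (I := Iio c) self_notMem_Iio hN₁ h₁ hl₁ (x := x) hx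
  have e₂ : ∀ x ∈ Ioi c, _ := fun x hx =>
    ofReal_mem_schurSpec_iff hAcpt (I := Ioi c) self_notMem_Ioi hN₂ h₂ hl₂ (x := x) hx
  ext z
  constructor
  · intro hz
    have him : z.im = 0 := by
      by_contra him
      exact hz.2 ((zero_mem_resolventSet_schur_iff hAcpt z).2
        (eigenspace_schur_zero_of_im_ne_zero hA him))
    obtain ⟨x, rfl⟩ : ∃ x : ℝ, (x : ℂ) = z := ⟨z.re, Complex.ext rfl him.symm⟩
    have hne : x ≠ c := fun h => hz.1 (congrArg _ h)
    rcases hne.lt_or_gt with hlt | hgt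
    · exact .inl ((e₁ x hlt).1 hz)
    · exact .inr ((e₂ x hgt).1 hz)
  · rintro (⟨j, hj, rfl⟩ | ⟨j, hj, rfl⟩)
    · exact (e₁ _ (hl₁.mem j hj)).2 ⟨j, hj, rfl⟩
    · exact (e₂ _ (hl₂.mem j hj)).2 ⟨j, hj, rfl⟩

/-- Left of a point α where N attains its minimum, κ ≤ N(x) ≤ N(x) + k(x) ≤ N(α) = κ, so k(x) = 0.
-/
theorem isIndexShift (hAcpt : HasCompactResolvent A)
    (hN : ∀ x ∈ Ioi c, IsCount (schurMap A B c x) 0 (N x) (k x))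
    (h : IsStepFunction (Ioi c) N k κ) : IsIndexShift A B c κ := by
  obtain ⟨α, hα, hNα⟩ := h.attained
  refine ⟨α, hα, fun x hx => ?_⟩
  have h1 := h.add_le x hx.1 α hα hx.2
  have h2 := h.min x hx.1
  have hNx : N x = κ := by omega
  have hkx : k x = 0 := by omega
  refine ⟨⟨fun h => hx.1.ne' (Complex.ofReal_injective h), ?_⟩, ?_⟩
  · rw [zero_mem_resolventSet_schur_iff hAcpt]
    have h3 := (hN x hx.1).edim_eigenspace
    rw [← schur_eq, Complex.ofReal_zero, hkx, edim, Nat.cast_zero,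
      Cardinal.toENat_eq_zero] at h3
    exact Submodule.rank_eq_zero.1 h3
  · rw [schur_eq, (hN x hx.1).edim_Iio, hNx]

/-- p₂ is bounded on any finite-dimensional subspace, so every x beyond its maximum and c makes N(x)
at least the dimension. Dimension m + 1 keeps the subspace nonzero. -/
theorem forall_exists_count_Ioi_iff (hA : IsSelfAdjoint A)
    (hN : ∀ x ∈ Ioi c, IsCount (schurMap A B c x) 0 (N x) (k x)) :
    (∀ m : ℕ, ∃ x ∈ Ioi c, m ≤ N x) ↔ ¬ FiniteDimensional ℂ H := by
  constructor
  · intro h hfin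
    obtain ⟨x, hx, hm⟩ := h (Module.finrank ℂ A.domain + 1)
    obtain ⟨L, hL, -⟩ := (hN x hx).exists_lt
    have h1 := L.finrank_le
    rw [Module.finrank_eq_of_rank_eq hL] at h1
    omega
  · intro hH m
    rw [← finiteDimensional_domain_iff hA] at hH
    obtain ⟨L, -, hL⟩ := exists_submodule_le_rank_eq (⊤ : Submodule ℂ A.domain) (m := m + 1)
      (by rw [rank_top]; exact natCast_le_rank hH _)
    have hp := isRootFunctional_p₂ (A := A) (B := B) (c := c)
    obtain ⟨M, -, hM⟩ := hp.exists_max L (finiteDimensional_of_rank_eq hL)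
      (ne_bot_of_rank_eq hL (Nat.succ_ne_zero m))
    have hx : max M c + 1 ∈ Ioi c := (le_max_right M c).trans_lt (lt_add_one _)
    refine ⟨_, hx, m.le_succ.trans (hp.le_of_forall_lt hN hx hL fun u hu hu0 => ?_)⟩
    exact (hM ⟨u, ⟨hu, hu0⟩, rfl⟩).trans_lt ((le_max_left M c).trans_lt (lt_add_one _))

/-- Where B* is injective, p₁ < c pointwise. On a finite-dimensional subspace the maximum is
attained, hence also below c, which leaves room for x. -/
theorem forall_exists_count_Iio_iff (hA : IsSelfAdjoint A) {N₀ k₀ : ℕ}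
    (hA₀ : IsCount A.toFun c N₀ k₀)
    (hN : ∀ x ∈ Iio c, IsCount (schurMap A B c x) 0 (N x) (k x)) :
    (∀ m : ℕ, ∃ x ∈ Iio c, m ≤ N x) ↔
      edim (LinearMap.range B.toLinearMap).topologicalClosure = ⊤ := by
  rw [edim_eq_top_iff]
  constructor
  · intro h hfin
    obtain ⟨x, hx, hm⟩ := h (N₀ + k₀ +
      Module.finrank ℂ (LinearMap.range B.toLinearMap).topologicalClosure + 1)
    have := count_le_of_finiteDimensional_range hA₀ hN hx
    omega
  · intro hB m
    obtain ⟨L, hL, hinj⟩ := exists_submodule_adjoint_injOn hA.dense_domain hB (m + 1)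
    have hp := isRootFunctional_p₁ (A := A) (B := B) (c := c)
    obtain ⟨M, ⟨v, ⟨hv, hv0⟩, rfl⟩, hM⟩ := hp.exists_max L (finiteDimensional_of_rank_eq hL)
      (ne_bot_of_rank_eq hL (Nat.succ_ne_zero m))
    obtain ⟨x, hMx, hx⟩ := exists_between
      (p₁_lt (B := B) (c := c) hv0 fun h => hv0 (hinj v hv h))
    refine ⟨x, hx, m.le_succ.trans (hp.le_of_forall_lt hN hx hL fun u hu hu0 => ?_)⟩
    exact (hM ⟨u, ⟨hu, hu0⟩, rfl⟩).trans_lt hMx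

theorem count_eq_zero_of_forall_lt {N₀ k₀ : ℕ} (hA₀ : IsCount A.toFun c N₀ k₀)
    (hlt : ∀ u : A.domain, u ≠ 0 → c * ‖(u : H)‖ ^ 2 < (inner ℂ (u : H) (A u)).re) :
    N₀ + k₀ = 0 := by
  by_contra h0
  obtain ⟨L, hL, hle⟩ := hA₀.exists_le
  obtain ⟨u, hu, hu0⟩ := L.ne_bot_iff.1 (ne_bot_of_rank_eq hL h0)
  exact absurd (hle u hu) (not_le.2 (hlt u hu0))

end

end RationalPencil

end


/-! ### The main theorem -/

open RationalPencil in
theorem theorem3p2 {H K : Type*}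
    [NormedAddCommGroup H] [InnerProductSpace ℂ H] [CompleteSpace H]
    [NormedAddCommGroup K] [InnerProductSpace ℂ K] [CompleteSpace K]
    (A : H →ₗ.[ℂ] H) (hA : IsSelfAdjoint A) (hAcpt : HasCompactResolvent A)
    (hAbdd : BoundedBelow A) (B : K →L[ℂ] H) (hB : B ≠ 0) (c : ℝ) :
    ∃ (n₁ n₂ : ℕ∞) (lam₁ lam₂ : ℕ → ℝ) (κ₂ : ℕ),
      -- the spectrum of `S` consists of two sequences of eigenvalues
      IsEigenvalueSequence A B c (Iio c) n₁ lam₁ ∧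
      IsEigenvalueSequence A B c (Ioi c) n₂ lam₂ ∧
      schurSpec A B c = schurPointSpec A B c ∧
      schurSpec A B c =
        {z : ℂ | ∃ j : ℕ, (j : ℕ∞) < n₁ ∧ z = (lam₁ j : ℂ)} ∪
          {z : ℂ | ∃ j : ℕ, (j : ℕ∞) < n₂ ∧ z = (lam₂ j : ℂ)} ∧
      -- the index shift
      IsIndexShift A B c κ₂ ∧
      -- the variational principles (`lam₁ j`, `lam₂ j` are the eigenvalues number `j + 1`)
      (∀ j : ℕ, (j : ℕ∞) < n₁ → IsMinMax A (p₁ A B c) (j + 1) (lam₁ j)) ∧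
      (∀ j : ℕ, (j : ℕ∞) < n₂ → IsMinMax A (p₂ A B c) (j + 1 + κ₂) (lam₂ j)) ∧
      -- estimates of the index shift
      (κ₂ : ℕ∞) ≤ eigenCount A c ∧
      ((∀ u : A.domain, u ≠ 0 → c * ‖(u : H)‖ ^ 2 < (inner ℂ (u : H) (A u)).re) → κ₂ = 0) ∧
      (IsClosed (range B) →
        (κ₂ : ℕ∞) ≤ edim (LinearMap.range ((spectralSubspace A (Iic c)).starProjection ∘L
          (LinearMap.ker (ContinuousLinearMap.adjoint B).toLinearMap).starProjection).toLinearMap) ∧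
        edim (LinearMap.range ((spectralSubspace A (Iic c)).starProjection ∘L
          (LinearMap.ker (ContinuousLinearMap.adjoint B).toLinearMap).starProjection).toLinearMap) ≤
            min (eigenCount A c) (edim (LinearMap.ker (ContinuousLinearMap.adjoint B).toLinearMap))) ∧
      -- infinitely many eigenvalues
      (n₂ = ⊤ ↔ ¬ FiniteDimensional ℂ H) ∧
      (n₂ = ⊤ → Tendsto lam₂ atTop atTop) ∧
      (n₁ = ⊤ ↔ edim (LinearMap.range B.toLinearMap).topologicalClosure = ⊤) ∧
      (n₁ = ⊤ → Tendsto lam₁ atTop (𝓝[<] c)) := by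
  have hex : ∀ x : ℝ, ∃ Nk : ℕ × ℕ, IsCount (schurMap A B c x) 0 Nk.1 Nk.2 := by
    intro x
    obtain ⟨N, k, h⟩ := exists_isCount_schurMap hA hAcpt hAbdd B c x
    exact ⟨(N, k), h⟩
  choose Nk hNk using hex
  have hN : ∀ I : Set ℝ, ∀ x ∈ I, IsCount (schurMap A B c x) 0 (Nk x).1 (Nk x).2 :=
    fun _ x _ => hNk x
  obtain ⟨ι, b, e, he⟩ := exists_isEigenbasis_toFun hA hAcpt hAbdd
  obtain ⟨N₀, k₀, hA₀⟩ := he.exists_isCount c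
  have hcount : eigenCount A c = (N₀ + k₀ : ℕ) := hA₀.edim_Iic
  have hp₁ := isRootFunctional_p₁ (A := A) (B := B) (c := c)
  have hp₂ := isRootFunctional_p₂ (A := A) (B := B) (c := c)
  have hs₁ : IsStepFunction (Iio c) (fun x => (Nk x).1) (fun x => (Nk x).2) 0 :=
    hp₁.isStepFunction (hN _) (fun _ _ => Nat.zero_le _) (exists_count_eq_zero hAbdd (hN _))
  -- The index shift is the least value of N on (c, ∞), attained because the values are natural
  -- numbers.
  obtain ⟨x₀, hx₀, hmin⟩ : ∃ x₀ ∈ Ioi c, ∀ x ∈ Ioi c, (Nk x₀).1 ≤ (Nk x).1 := by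
    obtain ⟨_, ⟨x₀, hx₀, rfl⟩, hle⟩ := WellFounded.has_min (wellFounded_lt (α := ℕ))
      ((fun x => (Nk x).1) '' Ioi c) (nonempty_Ioi.image _)
    exact ⟨x₀, hx₀, fun x hx => not_lt.1 (hle _ ⟨x, hx, rfl⟩)⟩
  set κ := (Nk x₀).1
  have hs₂ : IsStepFunction (Ioi c) (fun x => (Nk x).1) (fun x => (Nk x).2) κ :=
    hp₂.isStepFunction (hN _) hmin ⟨x₀, hx₀, rfl⟩
  obtain ⟨n₁, lam₁, hl₁⟩ := hs₁.exists_isJumpSequence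
  obtain ⟨n₂, lam₂, hl₂⟩ := hs₂.exists_isJumpSequence
  have hκ : κ ≤ N₀ + k₀ := le_of_isCount_toFun hA₀ (hN _) hmin
  refine ⟨n₁, n₂, lam₁, lam₂, κ, IsRootFunctional.isEigenvalueSequence (hN _) hs₁ hl₁,
    IsRootFunctional.isEigenvalueSequence (hN _) hs₂ hl₂, schurSpec_eq_schurPointSpec hAcpt,
    schurSpec_eq_union hA hAcpt (hN _) (hN _) hs₁ hs₂ hl₁ hl₂, isIndexShift hAcpt (hN _) hs₂,
    fun j hj => ?_, fun j hj => ?_, ?_, fun hlt => ?_, fun hB =>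
      ⟨le_edim_range_of_isClosed_range hA hAcpt hAbdd (hN _) hmin hB,
        edim_range_comp_starProjection_le _ _⟩, ?_, fun hn => ?_, ?_, fun hn => ?_⟩
  -- Indices start at 0: N ≤ j < N + k at the jump is N < j + 1 ≤ N + k.
  · have h := hl₁.bounds hj
    exact hp₁.isMinMax (hN _) (hl₁.mem j hj) (m := j + 1) (by omega) (by omega)
  · have h := hl₂.bounds hj
    exact hp₂.isMinMax (hN _) (hl₂.mem j hj) (m := j + 1 + κ) (by omega) (by omega)
  · rw [hcount]
    exact_mod_cast hκ
  · have := count_eq_zero_of_forall_lt hA₀ hlt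
    omega
  · exact hl₂.eq_top_iff.trans (forall_exists_count_Ioi_iff hA (hN _))
  · refine tendsto_atTop.2 fun M => ?_
    filter_upwards [hl₂.eventually_le hs₂ hn
      (show max M (c + 1) ∈ Ioi c from (lt_add_one c).trans_le (le_max_right _ _))] with j hj
    exact (le_max_left _ _).trans hj
  · exact hl₁.eq_top_iff.trans (forall_exists_count_Iio_iff hA hA₀ (hN _))
  · have hmem : ∀ j, lam₁ j < c := fun j => hl₁.mem j (hn ▸ ENat.natCast_lt_top j)
    refine tendsto_nhdsWithin_iff.2 ⟨tendsto_order.2 ⟨fun y hy => ?_, fun y hy => ?_⟩,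
      .of_forall hmem⟩
    · obtain ⟨x, hyx, hx⟩ := exists_between hy
      filter_upwards [hl₁.eventually_le hs₁ hn hx] with j hj
      exact hyx.trans_le hj
    · exact .of_forall fun j => (hmem j).trans hy
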